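/- Let $\mathcal H=\mathbb C^d$, $d\ge 2$, with computational basis $\{|j\rangle\}_{j=0}^{d-1}$, and let $\mathscr D^{\mathrm R}(\mathcal H)$ be the set of density matrices on $\mathcal H$ (positive semidefinite matrices of trace one) all of whose entries in this basis are real. Let $\mathcal H_A$, $\mathcal H_B$ be finite-dimensional Hilbert spaces with fixed bases. A (complex) masker for $\mathscr D^{\mathrm R}(\mathcal H)$ is an isometry $M:\mathcal H\to\mathcal H_A\otimes\mathcal H_B$ for which there are fixed matrices $\tau_A,\tau_B$ with $\mathrm{tr}_B(M\rho M^\dagger)=\tau_A$ and $\mathrm{tr}_A(M\rho M^\dagger)=\tau_B$ for all $\rho\in\mathscr D^{\mathrm R}(\mathcal H)$. It is a real masker if moreover $M\rho M^\dagger\in\mathscr D^{\mathrm R}(\mathcal H_A\otimes\mathcal H_B)$ (reality with respect to the product basis) for all $\rho\in\mathscr D^{\mathrm R}(\mathcal H)$. Its masking spectrum is the multiset of nonzero eigenvalues of $\tau_A$ (equivalently, of $\tau_B$), counted with multiplicity; it is denoted by $\{\lambda_o,m_o\}_o$ with distinct eigenvalues $\lambda_o$ of multiplicity $m_o$, or by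 $\{\mu_l\}_l$ with eigenvalues repeated according to multiplicity. Put $$\kappa(d)=2^{\lfloor (d-1)/2\rfloor},\qquad \kappa^{\mathrm R}(d)=\begin{cases}\kappa(d), & d\equiv 0,1,7 \pmod 8,\\ 2\kappa(d), & d\equiv 2,3,4,5,6 \pmod 8.\end{cases}$$ Let $\{\lambda_o,m_o\}_o$ be a finite family of distinct reals $\lambda_o>0$ and integers $m_o\ge1$ with $\sum_o m_o\lambda_o=1$. 1. If $d\ge 3$, there exist finite-dimensional $\mathcal H_A,\mathcal H_B$ and a complex masker $M:\mathcal H\to\mathcal H_A\otimes\mathcal H_B$ for $\mathscr D^{\mathrm R}(\mathcal H)$ with masking spectrum $\{\lambda_o,m_o\}_o$ if and only if every $m_o$ is divisible by $\kappa(d)$. 2. If $d\ge 2$, there exist finite-dimensional $\mathcal H_A,\mathcal H_B$ and a real masker $M:\mathcal H\to\mathcal H_A\otimes\mathcal H_B$ for $\mathscr D^{\mathrm R}(\mathcal H)$ with masking spectrum $\{\lambda_o,m_o\}_o$ if and only if every $m_o$ is divisible by $\kappa^{\mathrm R}(d)$. 3. Let $d=2$, and let $\{\mu_l\}_l$ be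 a finite family of (not necessarily distinct) positive reals with $\sum_l\mu_l=1$. There exist finite-dimensional $\mathcal H_A,\mathcal H_B$ and a complex masker for $\mathscr D^{\mathrm R}(\mathcal H)$ with masking spectrum $\{\mu_l\}_l$ if and only if there are signs $v_l\in\{1,-1\}$ with $\sum_l v_l\mu_l=0$. -/

import Mathlib

open scoped Matrix ComplexOrder

namespace QMask

/-- Quantum states (density matrices) on the Hilbert space with computational basis `n`. -/
def densityMatrices (n : Type*) [Fintype n] : Set (Matrix n n ℂ) :=
  {ρ | ρ.PosSemidef ∧ ρ.trace = 1}

/-- Real quantum states: density matrices all of whose entries in the computational basis are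
real. -/
def realDensityMatrices (n : Type*) [Fintype n] : Set (Matrix n n ℂ) :=
  {ρ | ρ ∈ densityMatrices n ∧ ∀ i j, (ρ i j).im = 0}

/-- The partial trace over the second factor. -/
def partialTraceB {A B : Type*} [Fintype B] (ρ : Matrix (A × B) (A × B) ℂ) : Matrix A A ℂ :=
  Matrix.of fun i j => ∑ k, ρ (i, k) (j, k)

/-- The partial trace over the first factor. -/
def partialTraceA {A B : Type*} [Fintype A] (ρ : Matrix (A × B) (A × B) ℂ) : Matrix B B ℂ :=
  Matrix.of fun i j => ∑ k, ρ (k, i) (k, j)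

/-- The action `ρ ↦ M ρ M†` on operators. -/
def conjBy {n N : Type*} [Fintype n] (M : Matrix N n ℂ) (ρ : Matrix n n ℂ) : Matrix N N ℂ :=
  M * ρ * Mᴴ

/-- `M` is an isometry from `ℂⁿ` to `ℂᴬ ⊗ ℂᴮ` that masks the set `S` of states, with common
reduced density matrices `τA` and `τB`. -/
structure IsMaskerWith {n A B : Type*} [Fintype n] [DecidableEq n] [Fintype A] [Fintype B]
    (M : Matrix (A × B) n ℂ) (S : Set (Matrix n n ℂ))
    (τA : Matrix A A ℂ) (τB : Matrix B B ℂ) : Prop where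
  isometry : Mᴴ * M = 1
  reducedA : ∀ ρ ∈ S, partialTraceB (conjBy M ρ) = τA
  reducedB : ∀ ρ ∈ S, partialTraceA (conjBy M ρ) = τB

/-- The output of `M` on every state in `S` is a real state. -/
def HasRealOutput {n A B : Type*} [Fintype n] [Fintype A] [Fintype B]
    (M : Matrix (A × B) n ℂ) (S : Set (Matrix n n ℂ)) : Prop :=
  ∀ ρ ∈ S, conjBy M ρ ∈ realDensityMatrices (A × B)

/-- The nonzero eigenvalues of a matrix, with (algebraic) multiplicity. -/
noncomputable def nonzeroSpectrum {n : Type*} [Fintype n] [DecidableEq n]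
    (τ : Matrix n n ℂ) : Multiset ℂ :=
  τ.charpoly.roots.filter (· ≠ 0)

/-- `M` is a masker for `S` with masking spectrum `σ`: the common reduced density matrices have
nonzero spectrum `σ`, a multiset of real numbers. -/
def IsMaskerWithSpectrum {n A B : Type*} [Fintype n] [DecidableEq n]
    [Fintype A] [DecidableEq A] [Fintype B] [DecidableEq B]
    (M : Matrix (A × B) n ℂ) (S : Set (Matrix n n ℂ)) (σ : Multiset ℝ) : Prop :=
  ∃ (τA : Matrix A A ℂ) (τB : Matrix B B ℂ), IsMaskerWith M S τA τB ∧
    nonzeroSpectrum τA = σ.map Complex.ofReal ∧ nonzeroSpectrum τB = σ.map Complex.ofReal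

/-- There is a (complex) masker for the real states in dimension `d`, into some finite-dimensional
bipartite space, with masking spectrum `σ`. -/
def ExistsComplexMasker (d : ℕ) (σ : Multiset ℝ) : Prop :=
  ∃ (a b : ℕ) (M : Matrix (Fin a × Fin b) (Fin d) ℂ),
    IsMaskerWithSpectrum M (realDensityMatrices (Fin d)) σ

/-- There is a real masker for the real states in dimension `d`, into some finite-dimensional
bipartite space, with masking spectrum `σ`. -/
def ExistsRealMasker (d : ℕ) (σ : Multiset ℝ) : Prop :=
  ∃ (a b : ℕ) (M : Matrix (Fin a × Fin b) (Fin d) ℂ),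
    IsMaskerWithSpectrum M (realDensityMatrices (Fin d)) σ ∧
      HasRealOutput M (realDensityMatrices (Fin d))

/-- The spectrum `{λ_o, m_o}_o` of a density matrix (zero eigenvalues omitted): distinct positive
eigenvalues `lam o` with positive multiplicities `m o`, of total weight one. -/
structure IsStateSpectrum {r : ℕ} (lam : Fin r → ℝ) (m : Fin r → ℕ) : Prop where
  injective : Function.Injective lam
  pos : ∀ o, 0 < lam o
  mult_pos : ∀ o, 0 < m o
  sum_eq_one : ∑ o, (m o : ℝ) * lam o = 1

/-- The multiset in which each `lam o` occurs `m o` times. -/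
def spectrumMultiset {r : ℕ} (lam : Fin r → ℝ) (m : Fin r → ℕ) : Multiset ℝ :=
  ∑ o, Multiset.replicate (m o) (lam o)

/-- `κ(d) = 2 ^ ⌊(d - 1) / 2⌋`, used for `d ≥ 2`. -/
def kappa (d : ℕ) : ℕ := 2 ^ ((d - 1) / 2)

/-- `κ^R(d)`: equal to `κ(d)` if `d ≡ 0, 1, 7 (mod 8)` and to `2 κ(d)` otherwise. -/
def kappaR (d : ℕ) : ℕ :=
  if d % 8 = 0 ∨ d % 8 = 1 ∨ d % 8 = 7 then kappa d else 2 * kappa d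

end QMask

/-!
Write the columns of an isometry into `ℂᴬ ⊗ ℂᴮ` as `A × B` matrices `X j`. Masking the pure states
with real amplitudes says that `Y * Yᴴ` and `Yᴴ * Y` depend only on the norm of the real vector `t`
in `Y = ∑ j, t j • X j`; by polarization, `X j * (X k)ᴴ + X k * (X j)ᴴ = 2 δⱼₖ τA`, and likewise on
the other side. The matrices `X (j + 1) * (X 0)ᴴ` then commute with `τA`, and on the eigenspace of
`τA` at `l ≠ 0` they are `l` times anticommuting operators of square `-1`. So every eigenspace is a
module over the Clifford algebra on `d - 1` generators, over `ℂ`, or over `ℝ` for a real masker,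
which is real up to a global phase. The irreducible modules have dimension `κ(d)` and `κᴿ(d)`:
products of generators that form commuting involutions, each negated by some generator, halve a
module repeatedly, and eight more generators multiply the dimension by `16`.

Conversely, skew-adjoint Clifford matrices `1, e 0, …, e (d - 2)` weighted by the square roots of
the spectrum are the columns of a masker. Isometry also demands `tr (X j * (X 0)ᴴ) = 0` for
`j ≠ 0`, which is automatic for at least two generators. For `d = 2` there is a single generator,
with eigenvalues `± i` that may be chosen freely, and the trace condition is the sign condition.
-/

namespace QMask

/-! ### Words in Clifford generators -/

section Words

variable {ι κ R S : Type*} [Ring R] [Ring S]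

/-- A Clifford family: pairwise anticommuting elements of a ring, each with square `-1`. -/
structure IsClifford (e : ι → R) : Prop where
  mul_self : ∀ i, e i * e i = -1
  anticomm : Pairwise fun i j => e i * e j = -(e j * e i)

theorem IsClifford.comp {e : ι → R} (h : IsClifford e) {f : κ → ι} (hf : f.Injective) :
    IsClifford (e ∘ f) :=
  ⟨fun i => h.mul_self (f i), fun _ _ hij => h.anticomm (hf.ne hij)⟩

theorem IsClifford.map {e : ι → R} (h : IsClifford e) (φ : R →+* S) :
    IsClifford fun i => φ (e i) :=
  ⟨fun i => by rw [← map_mul, h.mul_self, map_neg, map_one],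
    fun i j hij => by simpa only [map_mul, map_neg] using congrArg φ (h.anticomm hij)⟩

theorem IsClifford.isUnit {e : ι → R} (h : IsClifford e) (i : ι) : IsUnit (e i) :=
  ⟨⟨e i, -e i, by rw [mul_neg, h.mul_self, neg_neg], by rw [neg_mul, h.mul_self, neg_neg]⟩, rfl⟩

/-- The ordered product of the generators `e i` with `i` running through the list `L`. -/
def word (e : ι → R) (L : List ι) : R := (L.map e).prod

/-- The sign `ε` in the relation `word e L * word e M = ε • (word e M * word e L)` between words
in a Clifford family, as an integer that `decide` can evaluate. -/
def exchangeSign [DecidableEq ι] (L M : List ι) : ℤ :=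
  (L.map fun i => (M.map fun j => if i = j then 1 else -1).prod).prod

theorem mul_word {e : ι → R} {x : R} {σ : ι → ℤ} (L : List ι)
    (h : ∀ i ∈ L, x * e i = σ i • (e i * x)) :
    x * word e L = (L.map σ).prod • (word e L * x) := by
  induction L with
  | nil => simp [word]
  | cons i L ih =>
    have ih := ih fun j hj => h j (List.mem_cons_of_mem i hj)
    simp only [word, List.map_cons, List.prod_cons] at ih ⊢
    rw [← mul_assoc, h i List.mem_cons_self, smul_mul_assoc, mul_assoc, ih, mul_smul_comm,
      smul_smul, mul_assoc]

theorem word_mul {e : ι → R} {x : R} {σ : ι → ℤ} (L : List ι)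
    (h : ∀ i ∈ L, e i * x = σ i • (x * e i)) :
    word e L * x = (L.map σ).prod • (x * word e L) := by
  induction L with
  | nil => simp [word]
  | cons i L ih =>
    have ih := ih fun j hj => h j (List.mem_cons_of_mem i hj)
    simp only [word, List.map_cons, List.prod_cons] at ih ⊢
    rw [mul_assoc, ih, mul_smul_comm, ← mul_assoc, h i List.mem_cons_self, smul_mul_assoc,
      smul_smul, mul_assoc, mul_comm]

theorem word_mul_of_anticomm {e : ι → R} {x : R} {L : List ι}
    (h : ∀ i ∈ L, e i * x = -(x * e i)) :
    word e L * x = (-1 : ℤ) ^ L.length • (x * word e L) := by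
  rw [word_mul (σ := fun _ => -1) L fun i hi => by rw [h i hi, neg_one_smul], List.map_const',
    List.prod_replicate]

theorem commute_word_of_anticomm {e : ι → R} {x : R} {L : List ι} (hL : Even L.length)
    (h : ∀ i ∈ L, e i * x = -(x * e i)) : Commute x (word e L) := by
  rw [Commute, SemiconjBy, word_mul_of_anticomm h, hL.neg_one_pow, one_smul]

namespace IsClifford

variable {e : ι → R}

theorem word_mul_self (h : IsClifford e) {L : List ι} (hL : L.Nodup) :
    word e L * word e L = (-1 : ℤ) ^ (L.length + 1).choose 2 • (1 : R) := by
  induction L with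
  | nil => simp [word]
  | cons i L ih =>
    obtain ⟨hi, hL⟩ := List.nodup_cons.1 hL
    have hanti : word e L * e i = (-1 : ℤ) ^ L.length • (e i * word e L) :=
      word_mul_of_anticomm fun j hj => h.anticomm (ne_of_mem_of_not_mem hj hi)
    calc word e (i :: L) * word e (i :: L)
        = e i * (word e L * e i) * word e L := by
          simp only [word, List.map_cons, List.prod_cons, mul_assoc]
      _ = (-1 : ℤ) ^ L.length • (e i * e i * (word e L * word e L)) := by
          rw [hanti, mul_smul_comm, smul_mul_assoc]
          simp only [mul_assoc]
      _ = (-1 : ℤ) ^ ((i :: L).length + 1).choose 2 • (1 : R) := by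
          rw [h.mul_self, ih hL, neg_one_mul, ← smul_neg, ← neg_one_smul ℤ (1 : R), smul_smul,
            smul_smul, List.length_cons, Nat.choose_succ_succ' (L.length + 1) 1,
            Nat.choose_one_right]
          ring_nf

variable [DecidableEq ι]

theorem mul_eq_smul (h : IsClifford e) (i j : ι) :
    e i * e j = (if i = j then 1 else -1 : ℤ) • (e j * e i) := by
  split_ifs with hij
  · rw [hij, one_smul]
  · rw [neg_one_smul, h.anticomm hij]

theorem word_mul_word (h : IsClifford e) (L M : List ι) :
    word e L * word e M = exchangeSign L M • (word e M * word e L) :=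
  word_mul L fun i _ => mul_word M fun j _ => h.mul_eq_smul i j

theorem word_commute_word (h : IsClifford e) {L M : List ι} (hLM : exchangeSign L M = 1) :
    Commute (word e L) (word e M) := by
  rw [Commute, SemiconjBy, h.word_mul_word, hLM, one_smul]

theorem comp_word (h : IsClifford e) {w : κ → List ι}
    (hw : ∀ k, (w k).Nodup ∧ Odd (((w k).length + 1).choose 2))
    (hne : ∀ k l, k ≠ l → exchangeSign (w k) (w l) = -1) : IsClifford fun k => word e (w k) :=
  ⟨fun k => by rw [h.word_mul_self (hw k).1, (hw k).2.neg_one_pow, neg_one_smul],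
    fun k l hkl => by simpa only [hne k l hkl, neg_one_smul] using h.word_mul_word (w k) (w l)⟩

end IsClifford

end Words

/-! ### Halving a Clifford module by commuting involutions -/

section Halving

theorem map_eq_zero_of_anticomm {R G : Type*} [Ring R] [AddCommGroup G] [IsAddTorsionFree G]
    (t : R →+ G) (ht : ∀ x y, t (x * y) = t (y * x)) {x u : R} (hu : IsUnit u)
    (h : x * u = -(u * x)) : t x = 0 := by
  obtain ⟨u, rfl⟩ := hu
  refine self_eq_neg.1 ?_
  calc t x = t (x * u * ↑u⁻¹) := by rw [Units.mul_inv_cancel_right]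
    _ = t (↑u⁻¹ * (x * u)) := ht _ _
    _ = -t x := by rw [h, mul_neg, Units.inv_mul_cancel_left, map_neg]

/-- The projection `(1 + a) / 2` onto the fixed points of an involution `a`. -/
def fixedProj (K : Type*) {R : Type*} [Field K] [Ring R] [Algebra K R] (a : R) : R :=
  (2⁻¹ : K) • (1 + a)

theorem commute_fixedProj (K : Type*) {R : Type*} [Field K] [Ring R] [Algebra K R] {a x : R}
    (h : Commute x a) : Commute x (fixedProj K a) :=
  ((Commute.one_right x).add_right h).smul_right _

/-- The projection onto the joint fixed points of the words of a halving list. -/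
def jointFixedProj (K : Type*) {R ι : Type*} [Field K] [Ring R] [Algebra K R] (e : ι → R)
    (l : List (List ι × ι)) : R :=
  (l.map fun q => fixedProj K (word e q.1)).prod

theorem commute_jointFixedProj (K : Type*) {R ι : Type*} [Field K] [Ring R] [Algebra K R]
    {e : ι → R} {x : R} {l : List (List ι × ι)} (h : ∀ q ∈ l, Commute x (word e q.1)) :
    Commute x (jointFixedProj K e l) := by
  refine Commute.list_prod_right _ _ fun y hy => ?_
  obtain ⟨q, hq, rfl⟩ := List.mem_map.1 hy
  exact commute_fixedProj K (h q hq)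

variable {K V : Type*} [Field K] [CharZero K] [AddCommGroup V] [Module K V]

theorem isIdempotentElem_fixedProj {R : Type*} [Ring R] [Algebra K R] {a : R} (ha : a * a = 1) :
    IsIdempotentElem (fixedProj K a) := by
  have hsq : (1 + a) * (1 + a) = (2 : K) • (1 + a) := by
    rw [add_mul, mul_add, mul_add, ha, two_smul]
    noncomm_ring
  rw [IsIdempotentElem, fixedProj, smul_mul_smul_comm, hsq, smul_smul]
  norm_num

variable [FiniteDimensional K V]

theorem finrank_range_eq_two_mul {p a f : Module.End K V} (hp : IsIdempotentElem p)
    (ha : a * a = 1) (hf : IsUnit f) (haf : a * f = -(f * a)) (hpa : Commute p a)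
    (hpf : Commute p f) :
    Module.finrank K (LinearMap.range p) =
      2 * Module.finrank K (LinearMap.range (p * fixedProj K a)) := by
  have hpa_trace : LinearMap.trace K V (p * a) = 0 :=
    map_eq_zero_of_anticomm (LinearMap.trace K V).toAddMonoidHom (LinearMap.trace_mul_comm K) hf <|
      by rw [mul_assoc, haf, mul_neg, ← mul_assoc, hpf.eq, mul_assoc]
  have hidem : IsIdempotentElem (p * fixedProj K a) :=
    hp.mul_of_commute (commute_fixedProj K hpa) (isIdempotentElem_fixedProj ha)
  have htrace : LinearMap.trace K V p = 2 * LinearMap.trace K V (p * fixedProj K a) := by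
    rw [fixedProj, mul_smul_comm, map_smul, mul_add, mul_one, map_add, hpa_trace, add_zero,
      smul_eq_mul, mul_inv_cancel_left₀ two_ne_zero]
  rw [(LinearMap.IsIdempotentElem.isProj_range p hp).trace,
    (LinearMap.IsIdempotentElem.isProj_range _ hidem).trace] at htrace
  exact_mod_cast htrace

variable {ι : Type*} [DecidableEq ι]

/-- A halving list: words that form commuting involutions in every Clifford family, each paired
with a generator that anticommutes with it and commutes with all later words. Each pair halves the
space of joint fixed points. -/
def IsHalvingList (l : List (List ι × ι)) : Prop :=
  (∀ q ∈ l, q.1.Nodup ∧ Even ((q.1.length + 1).choose 2) ∧ exchangeSign q.1 [q.2] = -1) ∧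
    l.Pairwise fun q r => exchangeSign q.1 r.1 = 1 ∧ exchangeSign [q.2] r.1 = 1

instance (l : List (List ι × ι)) : Decidable (IsHalvingList l) :=
  inferInstanceAs (Decidable (_ ∧ _))

theorem IsClifford.finrank_eq_two_pow_mul {e : ι → Module.End K V} (h : IsClifford e)
    {l : List (List ι × ι)} (hl : IsHalvingList l) :
    IsIdempotentElem (jointFixedProj K e l) ∧ Module.finrank K V =
      2 ^ l.length * Module.finrank K (LinearMap.range (jointFixedProj K e l)) := by
  induction l with
  | nil =>
    refine ⟨.one, ?_⟩
    rw [List.length_nil, pow_zero, one_mul, jointFixedProj, List.map_nil, List.prod_nil,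
      Module.End.one_eq_id, LinearMap.range_id, finrank_top]
  | cons q l ih =>
    obtain ⟨L, i⟩ := q
    obtain ⟨hq, hl⟩ := hl
    obtain ⟨⟨hL, heven, hLi⟩, hq⟩ := List.forall_mem_cons.1 hq
    obtain ⟨hcomm, hl⟩ := List.pairwise_cons.1 hl
    obtain ⟨hidem, hrank⟩ := ih ⟨hq, hl⟩
    have hword (j : ι) : word e [j] = e j := by simp [word]
    have hsq : word e L * word e L = 1 := by rw [h.word_mul_self hL, heven.neg_one_pow, one_smul]
    have hanti : word e L * e i = -(e i * word e L) := by
      rw [← hword i, h.word_mul_word, hLi, neg_one_smul]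
    have hLl : Commute (word e L) (jointFixedProj K e l) :=
      commute_jointFixedProj K fun r hr => h.word_commute_word (hcomm r hr).1
    have hil : Commute (e i) (jointFixedProj K e l) :=
      commute_jointFixedProj K fun r hr => hword i ▸ h.word_commute_word (hcomm r hr).2
    have hcons : jointFixedProj K e ((L, i) :: l) =
        jointFixedProj K e l * fixedProj K (word e L) :=
      (commute_fixedProj K hLl.symm).eq.symm
    refine ⟨?_, ?_⟩
    · rw [hcons]
      exact hidem.mul_of_commute (commute_fixedProj K hLl.symm) (isIdempotentElem_fixedProj hsq)
    · rw [hrank, finrank_range_eq_two_mul hidem hsq (h.isUnit i) hanti hLl.symm hil.symm, hcons,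
        List.length_cons, pow_succ, mul_assoc]

end Halving

/-! ### Dimensions of Clifford modules -/

/-- `N` divides the dimension of every finite-dimensional `K`-linear representation of the Clifford
algebra on `n` generators of square `-1`. -/
def CliffordDvd (K : Type) [Field K] (N n : ℕ) : Prop :=
  ∀ (V : Type) [AddCommGroup V] [Module K V] [FiniteDimensional K V] (e : Fin n → Module.End K V),
    IsClifford e → N ∣ Module.finrank K V

namespace CliffordDvd

section Field

variable {K : Type} [Field K] {V : Type} [AddCommGroup V] [Module K V] [FiniteDimensional K V]
  {N n : ℕ}

theorem one : CliffordDvd K 1 n := fun _ _ _ _ _ _ => one_dvd _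

theorem succ (h : CliffordDvd K N n) : CliffordDvd K N (n + 1) := fun V _ _ _ _ he =>
  h V _ (he.comp (Fin.succ_injective n))

theorem dvd_finrank_submodule (h : CliffordDvd K N n) {T : Fin n → Module.End K V}
    {W : Submodule K V} (hW : ∀ i, ∀ v ∈ W, T i v ∈ W) (hsq : ∀ i, ∀ v ∈ W, T i (T i v) = -v)
    (hanti : Pairwise fun i j => ∀ v ∈ W, T i (T j v) = -T j (T i v)) :
    N ∣ Module.finrank K W :=
  h W (fun i => (T i).restrict (hW i))
    ⟨fun i => LinearMap.ext fun v => Subtype.ext (hsq i v v.2),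
      fun _ _ hij => LinearMap.ext fun v => Subtype.ext (hanti hij v v.2)⟩

theorem dvd_finrank_range (h : CliffordDvd K N n) {e : Fin n → Module.End K V} (he : IsClifford e)
    {p : Module.End K V} (hp : ∀ i, Commute (e i) p) :
    N ∣ Module.finrank K (LinearMap.range p) := by
  refine h.dvd_finrank_submodule (T := e) ?_ (fun i v _ => LinearMap.congr_fun (he.mul_self i) v)
    fun i j hij v _ => LinearMap.congr_fun (he.anticomm hij) v
  rintro i _ ⟨v, rfl⟩
  exact ⟨e i v, LinearMap.congr_fun (hp i).eq.symm v⟩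

theorem two_pow_mul_dvd_finrank [CharZero K] (h : CliffordDvd K N n) {ι : Type*} [DecidableEq ι]
    {e : ι → Module.End K V} (he : IsClifford e) {l : List (List ι × ι)} (hl : IsHalvingList l)
    {g : Fin n → Module.End K V} (hg : IsClifford g)
    (hgl : ∀ i, ∀ q ∈ l, Commute (g i) (word e q.1)) :
    2 ^ l.length * N ∣ Module.finrank K V := by
  rw [(he.finrank_eq_two_pow_mul hl).2]
  exact mul_dvd_mul_left _ (h.dvd_finrank_range hg fun i => commute_jointFixedProj K (hgl i))

end Field

theorem complex_add_two {N n : ℕ} (h : CliffordDvd ℂ N n) : CliffordDvd ℂ (2 * N) (n + 2) := by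
  intro V _ _ _ e he
  have hsq : word e [0, 1] * word e [0, 1] = -1 := by
    simpa using he.word_mul_self (L := [0, 1]) (by simp)
  have hanti : word e [0, 1] * e 0 = -(e 0 * word e [0, 1]) := by
    simpa [word, mul_assoc] using congrArg (e 0 * ·) (he.anticomm (i := 1) (j := 0) (by simp))
  have hcomm (i : Fin n) : Commute (e i.succ.succ) (word e [0, 1]) :=
    commute_word_of_anticomm (by simp) fun j hj => he.anticomm <| by
      rcases List.mem_pair.1 hj with rfl | rfl <;> simp [Fin.ext_iff]
  have hinv : Complex.I • word e [0, 1] * Complex.I • word e [0, 1] = 1 := by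
    rw [smul_mul_smul_comm, Complex.I_mul_I, hsq, neg_smul, one_smul, neg_neg]
  rw [← finrank_top ℂ V, ← LinearMap.range_id, ← Module.End.one_eq_id,
    finrank_range_eq_two_mul .one hinv (he.isUnit 0)
      (by rw [smul_mul_assoc, mul_smul_comm, hanti, smul_neg]) (.one_left _) (.one_left _)]
  exact mul_dvd_mul_left 2 <| h.dvd_finrank_range
    (he.comp ((Fin.succ_injective _).comp (Fin.succ_injective n))) fun i =>
      (Commute.one_right _).mul_right (commute_fixedProj ℂ ((hcomm i).smul_right _))

theorem complex (n : ℕ) : CliffordDvd ℂ (2 ^ (n / 2)) n := by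
  induction n using Nat.twoStepInduction with
  | zero => exact one
  | one => exact one
  | more n ih _ =>
    rw [Nat.add_div_right n two_pos, pow_succ']
    exact ih.complex_add_two

theorem real_one : CliffordDvd ℝ 2 1 := by
  intro V _ _ _ e he
  have hdet := congrArg LinearMap.det (he.mul_self 0)
  rw [map_mul, ← neg_one_smul ℝ (1 : Module.End ℝ V), LinearMap.det_smul, map_one, mul_one] at hdet
  rw [← even_iff_two_dvd, ← Nat.not_odd_iff_even]
  intro hodd
  rw [hodd.neg_one_pow] at hdet
  linarith [mul_self_nonneg (LinearMap.det (e 0))]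

theorem real_two : CliffordDvd ℝ 4 2 := by
  intro V _ _ _ e he
  let b : QuaternionAlgebra.Basis (Module.End ℝ V) (-1 : ℝ) 0 (-1) :=
    { i := e 0, j := e 1, k := e 0 * e 1
      i_mul_i := by simp [he.mul_self]
      j_mul_j := by simp [he.mul_self]
      i_mul_j := rfl
      j_mul_i := by simpa using he.anticomm (by decide : (1 : Fin 2) ≠ 0) }
  let _ : Module (Quaternion ℝ) V := Module.compHom V b.liftHom.toRingHom
  have : IsScalarTower ℝ (Quaternion ℝ) V :=
    ⟨fun r x v => LinearMap.congr_fun (b.lift_smul r x) v⟩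
  have hrank := Module.finrank_mul_finrank ℝ (Quaternion ℝ) V
  rw [Quaternion.finrank_eq_four] at hrank
  exact ⟨_, hrank.symm⟩

theorem real_four : CliffordDvd ℝ 8 4 := by
  intro V _ _ _ e he
  refine real_two.two_pow_mul_dvd_finrank he (l := [([0, 1, 2, 3], 3)]) (by decide)
    (he.comp_word (w := ![[0, 1], [0, 2]]) (by decide) (by decide)) fun i q hq => ?_
  refine he.word_commute_word ?_
  revert i q
  decide

/-- The words span the extended Hamming code: its elements have lengths divisible by `4` and
pairwise even overlaps, so the words square to `1` and commute. -/
theorem real_add_eight {N n : ℕ} (h : CliffordDvd ℝ N n) : CliffordDvd ℝ (16 * N) (n + 8) := by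
  intro V _ _ _ e he
  refine h.two_pow_mul_dvd_finrank (he.comp (Fin.natAdd_injective 8 n))
    (l := [([0, 1, 2, 3, 4, 5, 6, 7], 7), ([0, 2, 4, 6], 6), ([0, 1, 4, 5], 5), ([0, 1, 2, 3], 3)])
    (by decide) (he.comp (Fin.castAdd_injective n 8)) fun i q hq => ?_
  refine commute_word_of_anticomm ?_ fun j _ => he.anticomm ?_
  · revert q
    decide
  · rw [Ne, Fin.ext_iff, Fin.val_natAdd, Fin.val_castAdd]
    omega

end CliffordDvd

theorem kappa_add_eight (n : ℕ) : kappa (n + 8 + 1) = 16 * kappa (n + 1) := by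
  rw [kappa, kappa, show (n + 8 + 1 - 1) / 2 = (n + 1 - 1) / 2 + 4 by omega, pow_add]
  ring

theorem kappaR_add_eight (n : ℕ) : kappaR (n + 8 + 1) = 16 * kappaR (n + 1) := by
  rw [kappaR, kappaR, kappa_add_eight, show (n + 8 + 1) % 8 = (n + 1) % 8 by omega, mul_ite,
    mul_left_comm]

theorem CliffordDvd.real (n : ℕ) : CliffordDvd ℝ (kappaR (n + 1)) n := by
  induction n using Nat.strong_induction_on with
  | _ n ih =>
    match n with
    | 0 => exact one
    | 1 => exact real_one
    | 2 => exact real_two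
    | 3 => exact real_two.succ
    | 4 => exact real_four
    | 5 => exact real_four.succ
    | 6 => exact real_four.succ.succ
    | 7 => exact real_four.succ.succ.succ
    | n + 8 =>
      rw [kappaR_add_eight]
      exact (ih n (by omega)).real_add_eight

/-! ### Skew-adjoint Clifford matrices -/

/-- A Clifford family of skew-adjoint elements of a star ring. -/
structure IsSkewClifford {ι R : Type*} [Ring R] [StarRing R] (e : ι → R) : Prop
    extends IsClifford e where
  star_eq : ∀ i, star (e i) = -e i

section StarRing

variable {ι κ R S : Type*} [Ring R] [StarRing R] [Ring S] [StarRing S]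

theorem IsSkewClifford.of_isEmpty [IsEmpty ι] (e : ι → R) : IsSkewClifford e :=
  ⟨⟨isEmptyElim, fun i => isEmptyElim i⟩, isEmptyElim⟩

theorem IsSkewClifford.const_unit {x : R} (hx : x * x = -1) (hstar : star x = -x) :
    IsSkewClifford fun _ : Unit => x :=
  ⟨⟨fun _ => hx, Subsingleton.pairwise⟩, fun _ => hstar⟩

theorem IsSkewClifford.comp {e : ι → R} (h : IsSkewClifford e) {f : κ → ι} (hf : f.Injective) :
    IsSkewClifford (e ∘ f) :=
  ⟨h.toIsClifford.comp hf, fun i => h.star_eq (f i)⟩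

theorem IsSkewClifford.map {e : ι → R} (h : IsSkewClifford e) (φ : R →+* S)
    (hφ : ∀ x, φ (star x) = star (φ x)) : IsSkewClifford fun i => φ (e i) :=
  ⟨h.toIsClifford.map φ, fun i => by rw [← hφ, h.star_eq, map_neg]⟩

theorem IsSkewClifford.sumElim {u : ι → R} {v : κ → R} (hu : IsSkewClifford u)
    (hv : IsSkewClifford v) (huv : ∀ i k, u i * v k = -(v k * u i)) :
    IsSkewClifford (Sum.elim u v) := by
  refine ⟨⟨Sum.forall.2 ⟨hu.mul_self, hv.mul_self⟩, ?_⟩, Sum.forall.2 ⟨hu.star_eq, hv.star_eq⟩⟩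
  rintro (i | k) (j | l) hne
  · exact hu.anticomm (by simpa using hne)
  · exact huv i l
  · exact (neg_eq_iff_eq_neg.2 (huv j k)).symm
  · exact hv.anticomm (by simpa using hne)

end StarRing

section Pauli

variable (K : Type*) [CommRing K]

/-- The Pauli matrix `X`. -/
def pauliX : Matrix (Fin 2) (Fin 2) K := !![0, 1; 1, 0]

/-- The Pauli matrix `Z`. -/
def pauliZ : Matrix (Fin 2) (Fin 2) K := !![1, 0; 0, -1]

/-- The rotation by a quarter turn: `i` times the Pauli matrix `Y`, a real matrix. -/
def quarterTurn : Matrix (Fin 2) (Fin 2) K := !![0, 1; -1, 0]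

theorem pauliX_mul_self : pauliX K * pauliX K = 1 := by
  simp [pauliX, Matrix.one_fin_two]

theorem pauliZ_mul_self : pauliZ K * pauliZ K = 1 := by
  simp [pauliZ, Matrix.one_fin_two]

theorem pauliX_mul_pauliZ : pauliX K * pauliZ K = -(pauliZ K * pauliX K) := by
  simp [pauliX, pauliZ]

theorem pauliX_mul_quarterTurn : pauliX K * quarterTurn K = -(quarterTurn K * pauliX K) := by
  simp [pauliX, quarterTurn]

theorem pauliZ_mul_quarterTurn : pauliZ K * quarterTurn K = -(quarterTurn K * pauliZ K) := by
  simp [pauliZ, quarterTurn]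

variable [StarRing K]

theorem star_pauliX : star (pauliX K) = pauliX K := by
  ext i j; fin_cases i <;> fin_cases j <;> simp [pauliX]

theorem star_pauliZ : star (pauliZ K) = pauliZ K := by
  ext i j; fin_cases i <;> fin_cases j <;> simp [pauliZ]

theorem isSkewClifford_quarterTurn : IsSkewClifford fun _ : Unit => quarterTurn K := by
  refine .const_unit ?_ ?_
  · simp [quarterTurn, Matrix.one_fin_two]
  · ext i j; fin_cases i <;> fin_cases j <;> simp [quarterTurn]

end Pauli

section Kronecker

open scoped Kronecker

variable {K ι κ I J : Type*} [CommRing K]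

theorem neg_kronecker (x : Matrix I I K) (y : Matrix J J K) : (-x) ⊗ₖ y = -(x ⊗ₖ y) :=
  Matrix.ext fun _ _ => neg_mul _ _

theorem kronecker_neg (x : Matrix I I K) (y : Matrix J J K) : x ⊗ₖ (-y) = -(x ⊗ₖ y) :=
  Matrix.ext fun _ _ => mul_neg _ _

variable [Fintype I] [Fintype J]

theorem kronecker_mul_kronecker_eq_neg {a b : Matrix I I K} {x y : Matrix J J K}
    (hab : Commute a b) (hxy : x * y = -(y * x)) :
    (a ⊗ₖ x) * (b ⊗ₖ y) = -((b ⊗ₖ y) * (a ⊗ₖ x)) := by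
  rw [← Matrix.mul_kronecker_mul, ← Matrix.mul_kronecker_mul, hab.eq, hxy, kronecker_neg]

/-- The doubling of two commuting Clifford families on `I`: a Clifford family on two copies of `I`
with one generator more than both families together. -/
def double [DecidableEq I] (u : ι → Matrix I I K) (v : κ → Matrix I I K) :
    ι ⊕ κ ⊕ Unit → Matrix (I × Fin 2) (I × Fin 2) K :=
  Sum.elim (fun i => u i ⊗ₖ pauliX K)
    (Sum.elim (fun k => v k ⊗ₖ pauliZ K) fun _ => 1 ⊗ₖ quarterTurn K)

/-- Left multiplication by three anticommuting unit quaternions, on the real quaternions with a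
suitable basis. -/
def quaternionLeft (K : Type*) [CommRing K] :
    Unit ⊕ Unit ⊕ Unit → Matrix (Fin 2 × Fin 2) (Fin 2 × Fin 2) K :=
  double (fun _ => quarterTurn K) fun _ => quarterTurn K

/-- Right multiplication by three anticommuting unit quaternions: `quaternionLeft` with the two
tensor factors exchanged. -/
def quaternionRight (K : Type*) [CommRing K] (i : Unit ⊕ Unit ⊕ Unit) :
    Matrix (Fin 2 × Fin 2) (Fin 2 × Fin 2) K :=
  Matrix.reindexAlgEquiv K K (Equiv.prodComm _ _) (quaternionLeft K i)

theorem commute_quaternionLeft_quaternionRight (i j : Unit ⊕ Unit ⊕ Unit) :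
    Commute (quaternionLeft K i) (quaternionRight K j) := by
  have hswap (x y : Matrix (Fin 2) (Fin 2) K) :
      Matrix.reindexAlgEquiv K K (Equiv.prodComm _ _) (x ⊗ₖ y) = y ⊗ₖ x :=
    Matrix.ext fun _ _ => mul_comm _ _
  rcases i with _ | _ | _ <;> rcases j with _ | _ | _ <;>
    simp only [Commute, SemiconjBy, quaternionRight, quaternionLeft, double, Sum.elim_inl,
      Sum.elim_inr, hswap, ← Matrix.mul_kronecker_mul, pauliX_mul_quarterTurn,
      pauliZ_mul_quarterTurn, neg_kronecker, kronecker_neg, mul_one, one_mul]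

variable [DecidableEq I] [DecidableEq J] [StarRing K]

theorem IsSkewClifford.kronecker {u : ι → Matrix I I K} (hu : IsSkewClifford u)
    {x : Matrix J J K} (hx : x * x = 1) (hstar : star x = x) :
    IsSkewClifford fun i => u i ⊗ₖ x := by
  refine ⟨⟨fun i => ?_, fun i j hij => ?_⟩, fun i => ?_⟩
  · rw [← Matrix.mul_kronecker_mul, hu.mul_self, hx, neg_kronecker, Matrix.one_kronecker_one]
  · simp only [← Matrix.mul_kronecker_mul, hu.anticomm hij, neg_kronecker]
  · rw [Matrix.star_eq_conjTranspose, Matrix.conjTranspose_kronecker,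
      ← Matrix.star_eq_conjTranspose, ← Matrix.star_eq_conjTranspose, hu.star_eq, hstar,
      neg_kronecker]

theorem IsSkewClifford.one_kronecker {u : ι → Matrix J J K} (hu : IsSkewClifford u) :
    IsSkewClifford fun i => (1 : Matrix I I K) ⊗ₖ u i := by
  refine ⟨⟨fun i => ?_, fun i j hij => ?_⟩, fun i => ?_⟩
  · rw [← Matrix.mul_kronecker_mul, hu.mul_self, one_mul, kronecker_neg, Matrix.one_kronecker_one]
  · simp only [← Matrix.mul_kronecker_mul, hu.anticomm hij, kronecker_neg]
  · rw [Matrix.star_eq_conjTranspose, Matrix.conjTranspose_kronecker, Matrix.conjTranspose_one,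
      ← Matrix.star_eq_conjTranspose, hu.star_eq, kronecker_neg]

theorem IsSkewClifford.double {u : ι → Matrix I I K} {v : κ → Matrix I I K}
    (hu : IsSkewClifford u) (hv : IsSkewClifford v) (huv : ∀ i k, Commute (u i) (v k)) :
    IsSkewClifford (double u v) := by
  refine (hu.kronecker (pauliX_mul_self K) (star_pauliX K)).sumElim
    ((hv.kronecker (pauliZ_mul_self K) (star_pauliZ K)).sumElim
      (isSkewClifford_quarterTurn K).one_kronecker ?_) ?_
  · exact fun k _ => kronecker_mul_kronecker_eq_neg (.one_right _) (pauliZ_mul_quarterTurn K)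
  · rintro i (k | _)
    · exact kronecker_mul_kronecker_eq_neg (huv i k) (pauliX_mul_pauliZ K)
    · exact kronecker_mul_kronecker_eq_neg (.one_right _) (pauliX_mul_quarterTurn K)

theorem isSkewClifford_quaternionLeft : IsSkewClifford (quaternionLeft K) :=
  (isSkewClifford_quarterTurn K).double (isSkewClifford_quarterTurn K) fun _ _ => .refl _

theorem isSkewClifford_reindex {e : ι → Matrix I I K} (h : IsSkewClifford e) (f : I ≃ J) :
    IsSkewClifford fun i => Matrix.reindexAlgEquiv K K f (e i) :=
  h.map (Matrix.reindexAlgEquiv K K f).toRingEquiv.toRingHom fun x =>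
    (Matrix.conjTranspose_reindex f f x).symm

theorem isSkewClifford_quaternionRight : IsSkewClifford (quaternionRight K) :=
  isSkewClifford_reindex isSkewClifford_quaternionLeft _

end Kronecker

theorem isSkewClifford_I (I : Type*) [Fintype I] [DecidableEq I] :
    IsSkewClifford fun _ : Unit => Complex.I • (1 : Matrix I I ℂ) :=
  .const_unit (by simp [smul_smul]) (by simp [star_smul])

/-- There are `n` anticommuting skew-Hermitian `N × N` matrices of square `-1` over `K`. -/
def ExistsSkewClifford (K : Type*) [CommRing K] [StarRing K] (N n : ℕ) : Prop :=
  ∃ e : Fin n → Matrix (Fin N) (Fin N) K, IsSkewClifford e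

namespace ExistsSkewClifford

open scoped Kronecker

variable {K : Type*} [CommRing K] [StarRing K] {N n : ℕ}

theorem of_isSkewClifford {ι I : Type*} [Fintype ι] [Fintype I] [DecidableEq I]
    {e : ι → Matrix I I K} (h : IsSkewClifford e) :
    ExistsSkewClifford K (Fintype.card I) (Fintype.card ι) :=
  ⟨_, isSkewClifford_reindex (h.comp (Fintype.equivFin ι).symm.injective) (Fintype.equivFin I)⟩

theorem of_succ (h : ExistsSkewClifford K N (n + 1)) : ExistsSkewClifford K N n :=
  let ⟨_, he⟩ := h
  ⟨_, he.comp (Fin.succ_injective n)⟩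

theorem zero : ExistsSkewClifford K 1 0 := ⟨_, .of_isEmpty 0⟩

theorem one : ExistsSkewClifford K 2 1 :=
  of_isSkewClifford (isSkewClifford_quarterTurn K)

theorem three : ExistsSkewClifford K 4 3 :=
  of_isSkewClifford (isSkewClifford_quaternionLeft (K := K))

theorem seven : ExistsSkewClifford K 8 7 :=
  of_isSkewClifford (isSkewClifford_quaternionLeft.double isSkewClifford_quaternionRight
    (commute_quaternionLeft_quaternionRight (K := K)))

theorem add_eight (h : ExistsSkewClifford K N n) : ExistsSkewClifford K (16 * N) (n + 8) := by
  obtain ⟨u, hu⟩ := seven (K := K)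
  obtain ⟨v, hv⟩ := h
  have hcomm (i : Fin 7) (k : Fin n) :
      Commute (u i ⊗ₖ (1 : Matrix (Fin N) (Fin N) K)) ((1 : Matrix (Fin 8) (Fin 8) K) ⊗ₖ v k) := by
    simp [Commute, SemiconjBy, ← Matrix.mul_kronecker_mul]
  convert of_isSkewClifford ((hu.kronecker (one_mul 1) (star_one _)).double hv.one_kronecker hcomm)
    using 1
  · simp; ring
  · simp; ring

theorem complex_one : ExistsSkewClifford ℂ 1 1 :=
  of_isSkewClifford (isSkewClifford_I Unit)

theorem complex_add_two (h : ExistsSkewClifford ℂ N n) : ExistsSkewClifford ℂ (2 * N) (n + 2) := by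
  obtain ⟨e, he⟩ := h
  convert of_isSkewClifford (he.double (isSkewClifford_I (Fin N)) fun _ _ =>
    (Commute.one_right _).smul_right _)
    using 1
  · simp [mul_comm]
  · simp

theorem complex (n : ℕ) : ExistsSkewClifford ℂ (2 ^ (n / 2)) n := by
  induction n using Nat.twoStepInduction with
  | zero => exact zero
  | one => exact complex_one
  | more n ih _ =>
    rw [Nat.add_div_right n two_pos, pow_succ']
    exact ih.complex_add_two

theorem real (n : ℕ) : ExistsSkewClifford ℝ (kappaR (n + 1)) n := by
  induction n using Nat.strong_induction_on with
  | _ n ih =>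
    match n with
    | 0 => exact zero
    | 1 => exact one
    | 2 => exact three.of_succ
    | 3 => exact three
    | 4 => exact seven.of_succ.of_succ.of_succ
    | 5 => exact seven.of_succ.of_succ
    | 6 => exact seven.of_succ
    | 7 => exact seven
    | n + 8 =>
      rw [kappaR_add_eight]
      exact (ih n (by omega)).add_eight

end ExistsSkewClifford

/-! ### Maskers of real states as Hurwitz families -/

section RealStates

variable {ι E : Type*} [Fintype ι] [AddCommGroup E] [Module ℂ E]

/-- The pure state with amplitudes proportional to the nonzero real vector `v`. -/
noncomputable def pureState (v : ι → ℝ) : Matrix ι ι ℂ :=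
  ((v ⬝ᵥ v : ℝ) : ℂ)⁻¹ • Matrix.vecMulVec (Complex.ofReal ∘ v) (Complex.ofReal ∘ v)

theorem pureState_mem_realDensityMatrices {v : ι → ℝ} (hv : v ≠ 0) :
    pureState v ∈ realDensityMatrices ι := by
  have hpos : 0 < v ⬝ᵥ v := by simpa using Matrix.dotProduct_star_self_pos_iff.2 hv
  have hreal : pureState v = (Matrix.vecMulVec v v |>.map fun x => (((v ⬝ᵥ v)⁻¹ * x : ℝ) : ℂ)) := by
    ext; simp [pureState, Matrix.vecMulVec_apply]
  refine ⟨⟨?_, ?_⟩, fun i j => by rw [hreal]; exact Complex.ofReal_im _⟩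
  · have hstar : star (Complex.ofReal ∘ v) = Complex.ofReal ∘ v :=
      funext fun i => Complex.conj_ofReal (v i)
    have hpsd := Matrix.posSemidef_vecMulVec_self_star (Complex.ofReal ∘ v)
    rw [hstar] at hpsd
    exact hpsd.smul (by rw [← Complex.ofReal_inv, Complex.zero_le_real]; positivity)
  · rw [pureState, Matrix.trace_smul, Matrix.trace_vecMulVec, smul_eq_mul,
      show (Complex.ofReal ∘ v) ⬝ᵥ (Complex.ofReal ∘ v) = ((v ⬝ᵥ v : ℝ) : ℂ) by
        simp [dotProduct], inv_mul_cancel₀ (by exact_mod_cast hpos.ne')]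

theorem apply_symm_of_mem_realDensityMatrices {ρ : Matrix ι ι ℂ} (hρ : ρ ∈ realDensityMatrices ι)
    (j k : ι) : ρ j k = ρ k j := by
  rw [← hρ.1.1.isHermitian.apply j k]
  exact Complex.conj_eq_iff_im.2 (hρ.2 k j)

theorem sum_mul_smul_eq {F : ι → ι → E} {τ : E}
    (h : ∀ ρ ∈ realDensityMatrices ι, ∑ j, ∑ k, ρ j k • F j k = τ) (v : ι → ℝ) (hv : v ≠ 0) :
    ∑ j, ∑ k, ((v j * v k : ℝ) : ℂ) • F j k = ((v ⬝ᵥ v : ℝ) : ℂ) • τ := by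
  have hne : ((v ⬝ᵥ v : ℝ) : ℂ) ≠ 0 := by simpa using hv
  rw [← h _ (pureState_mem_realDensityMatrices hv)]
  simp only [pureState, Matrix.smul_apply, Matrix.vecMulVec_apply, smul_assoc, ← Finset.smul_sum]
  rw [smul_inv_smul₀ hne]
  simp

theorem forall_real_sum_smul_eq_iff {F : ι → ι → E} {τ : E} :
    (∀ ρ ∈ realDensityMatrices ι, ∑ j, ∑ k, ρ j k • F j k = τ) ↔
      (∀ j, F j j = τ) ∧ ∀ j k, j ≠ k → F j k + F k j = 0 := by
  classical
  refine ⟨fun h => ?_, fun ⟨hdiag, hoff⟩ ρ hρ => ?_⟩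
  · have hdiag (j : ι) : F j j = τ := by
      simpa [Pi.single_apply] using sum_mul_smul_eq h (Pi.single j 1) (by simp)
    refine ⟨hdiag, fun j k hjk => ?_⟩
    let v : ι → ℝ := Pi.single j 1 + Pi.single k 1
    have hsum (G : ι → E) : ∑ i, (v i : ℂ) • G i = G j + G k := by
      simp [v, Pi.single_apply, add_smul, Finset.sum_add_distrib, apply_ite Complex.ofReal]
    have hnorm : v ⬝ᵥ v = 2 := by simp [v, hjk, hjk.symm, one_add_one_eq_two]
    have hpair := sum_mul_smul_eq h v fun h0 => by simp [h0] at hnorm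
    simp only [Complex.ofReal_mul, mul_smul, ← Finset.smul_sum, hsum, hnorm, hdiag] at hpair
    rw [← add_right_inj ((2 : ℂ) • τ), add_zero]
    refine Eq.trans ?_ hpair
    module
  · have hterm (j k : ι) : ρ j k • (F j k + F k j) = if j = k then ρ j j • (2 : ℂ) • τ else 0 := by
      split_ifs with hjk
      · rw [← hjk, hdiag, two_smul]
      · rw [hoff j k hjk, smul_zero]
    refine smul_right_injective E (two_ne_zero (α := ℂ)) ?_
    calc (2 : ℂ) • ∑ j, ∑ k, ρ j k • F j k
        = ∑ j, ∑ k, ρ j k • F j k + ∑ k, ∑ j, ρ j k • F j k := by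
          rw [two_smul, Finset.sum_comm (f := fun k j => ρ j k • F j k)]
      _ = ∑ j, ∑ k, ρ j k • (F j k + F k j) := by
          simp only [smul_add, Finset.sum_add_distrib,
            apply_symm_of_mem_realDensityMatrices hρ]
      _ = ρ.trace • (2 : ℂ) • τ := by simp [hterm, Matrix.trace, Finset.sum_smul]
      _ = (2 : ℂ) • τ := by rw [hρ.1.2, one_smul]

end RealStates

section Columns

variable {𝕜 ι A B : Type*}

/-- The columns of a linear map into `𝕜ᴬ ⊗ 𝕜ᴮ`, as matrices. -/
def columns (M : Matrix (A × B) ι 𝕜) (j : ι) : Matrix A B 𝕜 :=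
  Matrix.of fun a b => M (a, b) j

/-- A Hurwitz family with Gram matrix `α`: every real linear combination `Y = ∑ t j • X j` of the
matrices satisfies `Y * Yᴴ = (∑ t j ^ 2) • α`. -/
structure IsHurwitz [CommRing 𝕜] [StarRing 𝕜] [Fintype B] (X : ι → Matrix A B 𝕜)
    (α : Matrix A A 𝕜) : Prop where
  mul_conjTranspose_self : ∀ j, X j * (X j)ᴴ = α
  add_eq_zero : ∀ j k, j ≠ k → X j * (X k)ᴴ + X k * (X j)ᴴ = 0

theorem conjTranspose_mul_apply [Fintype A] [Fintype B] (M : Matrix (A × B) ι ℂ) (j k : ι) :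
    (Mᴴ * M) j k = ((columns M j)ᴴ * columns M k).trace := by
  simp only [Matrix.trace, Matrix.diag_apply, Matrix.mul_apply, Matrix.conjTranspose_apply,
    columns, Matrix.of_apply]
  rw [Fintype.sum_prod_type_right]

variable [Fintype ι]

theorem conjBy_apply {N : Type*} (M : Matrix N ι ℂ) (ρ : Matrix ι ι ℂ) (x y : N) :
    conjBy M ρ x y = ∑ j, ∑ k, ρ j k • (M x j * star (M y k)) := by
  simp only [conjBy, Matrix.mul_apply, Finset.sum_mul, Matrix.conjTranspose_apply, smul_eq_mul]
  rw [Finset.sum_comm]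
  exact Finset.sum_congr rfl fun j _ => Finset.sum_congr rfl fun k _ => by ring

theorem partialTraceB_conjBy [Fintype B] (M : Matrix (A × B) ι ℂ) (ρ : Matrix ι ι ℂ) :
    partialTraceB (conjBy M ρ) = ∑ j, ∑ k, ρ j k • (columns M j * (columns M k)ᴴ) := by
  ext a a'
  simp only [partialTraceB, Matrix.of_apply, conjBy_apply, Matrix.sum_apply, Matrix.smul_apply,
    Matrix.mul_apply, Matrix.conjTranspose_apply, columns, Finset.smul_sum]
  rw [Finset.sum_comm]
  exact Finset.sum_congr rfl fun j _ => Finset.sum_comm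

theorem partialTraceA_conjBy [Fintype A] (M : Matrix (A × B) ι ℂ) (ρ : Matrix ι ι ℂ) :
    partialTraceA (conjBy M ρ) = ∑ j, ∑ k, ρ j k • ((columns M j)ᵀ * (columns M k)ᵀᴴ) :=
  partialTraceB_conjBy (M.submatrix Prod.swap id) ρ

theorem isMaskerWith_iff [DecidableEq ι] [Fintype A] [Fintype B] {M : Matrix (A × B) ι ℂ}
    {τA : Matrix A A ℂ} {τB : Matrix B B ℂ} :
    IsMaskerWith M (realDensityMatrices ι) τA τB ↔
      Mᴴ * M = 1 ∧ IsHurwitz (columns M) τA ∧ IsHurwitz (fun j => (columns M j)ᵀ) τB := by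
  have hA := forall_real_sum_smul_eq_iff (F := fun j k => columns M j * (columns M k)ᴴ) (τ := τA)
  have hB := forall_real_sum_smul_eq_iff (F := fun j k => (columns M j)ᵀ * (columns M k)ᵀᴴ)
    (τ := τB)
  simp only [← partialTraceB_conjBy] at hA
  simp only [← partialTraceA_conjBy] at hB
  exact ⟨fun h => ⟨h.1, ⟨(hA.1 h.2).1, (hA.1 h.2).2⟩, ⟨(hB.1 h.3).1, (hB.1 h.3).2⟩⟩,
    fun ⟨h, hXA, hXB⟩ => ⟨h, hA.2 ⟨hXA.1, hXA.2⟩, hB.2 ⟨hXB.1, hXB.2⟩⟩⟩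

end Columns

/-! ### Divisibility of the multiplicities -/

namespace IsHurwitz

section Relations

variable {𝕜 ι A B : Type*} [CommRing 𝕜] [StarRing 𝕜] {X : ι → Matrix A B 𝕜}
  {α : Matrix A A 𝕜} {β : Matrix B B 𝕜}

theorem conjTranspose_mul_self [Fintype A] (h : IsHurwitz (fun j => (X j)ᵀ) β) (j : ι) :
    (X j)ᴴ * X j = βᵀ := by
  rw [← h.mul_conjTranspose_self j, Matrix.transpose_mul, Matrix.transpose_transpose]
  rfl

variable [Fintype B]

theorem isHermitian (h : IsHurwitz X α) (j : ι) : α.IsHermitian := by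
  rw [← h.mul_conjTranspose_self j]
  exact Matrix.isHermitian_mul_conjTranspose_self _

theorem mul_conjTranspose_comm (h : IsHurwitz X α) {j k : ι} (hjk : j ≠ k) :
    X j * (X k)ᴴ = -(X k * (X j)ᴴ) :=
  eq_neg_of_add_eq_zero_left (h.add_eq_zero j k hjk)

theorem of_map {S : Type*} [CommRing S] [StarRing S] {f : 𝕜 →+* S} (hf : Function.Injective f)
    (hstar : ∀ x, f (star x) = star (f x))
    (h : IsHurwitz (fun j => (X j).map f) (α.map f)) : IsHurwitz X α := by
  have hmap (j k : ι) : (X j * (X k)ᴴ).map f = (X j).map f * ((X k).map f)ᴴ := by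
    rw [Matrix.map_mul, Matrix.conjTranspose_map f hstar]
  refine ⟨fun j => Matrix.map_injective hf ?_, fun j k hjk => Matrix.map_injective hf ?_⟩
  · exact (hmap j j).trans (h.mul_conjTranspose_self j)
  · beta_reduce
    rw [Matrix.map_add f (map_add f), hmap, hmap, h.add_eq_zero j k hjk,
      Matrix.map_zero f (map_zero f)]

variable [Fintype A]

theorem intertwines (h : IsHurwitz X α) (hβ : ∀ j, (X j)ᴴ * X j = β) (j : ι) :
    X j * β = α * X j := by
  rw [← hβ j, ← Matrix.mul_assoc, h.mul_conjTranspose_self]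

theorem commute_mul_conjTranspose (h : IsHurwitz X α) (hβ : ∀ j, (X j)ᴴ * X j = β) (j k : ι) :
    Commute (X j * (X k)ᴴ) α :=
  calc X j * (X k)ᴴ * α = X j * β * (X k)ᴴ := by
        rw [← h.mul_conjTranspose_self k, ← hβ k]; simp only [Matrix.mul_assoc]
    _ = α * (X j * (X k)ᴴ) := by rw [h.intertwines hβ, Matrix.mul_assoc]

theorem mul_conjTranspose_mul (h : IsHurwitz X α) (hβ : ∀ j, (X j)ᴴ * X j = β) {i k : ι}
    (hk : k ≠ i) (j : ι) :
    X j * (X i)ᴴ * (X k * (X i)ᴴ) = -(α * (X j * (X k)ᴴ)) :=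
  calc X j * (X i)ᴴ * (X k * (X i)ᴴ) = -(X j * ((X i)ᴴ * X i) * (X k)ᴴ) := by
        rw [h.mul_conjTranspose_comm hk, Matrix.mul_neg]; simp only [Matrix.mul_assoc]
    _ = -(α * (X j * (X k)ᴴ)) := by rw [hβ, h.intertwines hβ, Matrix.mul_assoc]

theorem mul_conjTranspose_mul_self (h : IsHurwitz X α) (hβ : ∀ j, (X j)ᴴ * X j = β) {i k : ι}
    (hk : k ≠ i) : X k * (X i)ᴴ * (X k * (X i)ᴴ) = -(α * α) := by
  rw [h.mul_conjTranspose_mul hβ hk, h.mul_conjTranspose_self]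

theorem mul_conjTranspose_anticomm (h : IsHurwitz X α) (hβ : ∀ j, (X j)ᴴ * X j = β) {i j k : ι}
    (hj : j ≠ i) (hk : k ≠ i) (hjk : j ≠ k) :
    X j * (X i)ᴴ * (X k * (X i)ᴴ) = -(X k * (X i)ᴴ * (X j * (X i)ᴴ)) := by
  rw [h.mul_conjTranspose_mul hβ hk, h.mul_conjTranspose_mul hβ hj,
    h.mul_conjTranspose_comm hjk, Matrix.mul_neg]

end Relations

end IsHurwitz

theorem CliffordDvd.dvd_finrank_eigenspace {K V : Type} [Field K] [AddCommGroup V] [Module K V]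
    [FiniteDimensional K V] {N n : ℕ} (hN : CliffordDvd K N n) {a : Module.End K V}
    {T : Fin n → Module.End K V} (hcomm : ∀ j, Commute (T j) a)
    (hsq : ∀ j, T j * T j = -(a * a)) (hanti : Pairwise fun j k => T j * T k = -(T k * T j))
    {c : K} (hc : c ≠ 0) : N ∣ Module.finrank K (a.eigenspace c) := by
  refine hN.dvd_finrank_submodule (T := fun j => c⁻¹ • T j) (fun j v hv => ?_) (fun j v hv => ?_)
    fun j k hjk v _ => ?_
  · rw [Module.End.mem_eigenspace_iff] at hv ⊢
    rw [← Module.End.mul_apply, ((hcomm j).smul_left c⁻¹).eq.symm, Module.End.mul_apply, hv,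
      map_smul]
  · have hTT : T j (T j v) = -(c • c • v) := by
      rw [Module.End.mem_eigenspace_iff] at hv
      simpa [hv] using LinearMap.congr_fun (hsq j) v
    simp [hTT, hc]
  · have hTT : T j (T k v) = -T k (T j v) := LinearMap.congr_fun (hanti hjk) v
    simp [hTT]

theorem finrank_eigenspace_toLpLinAlgEquiv {𝕜 A : Type*} [RCLike 𝕜] [Fintype A] [DecidableEq A]
    {α : Matrix A A 𝕜} (hα : α.IsHermitian) (c : 𝕜) :
    Module.finrank 𝕜 (Module.End.eigenspace (Matrix.toLpLinAlgEquiv 2 α) c) =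
      α.charpoly.rootMultiplicity c := by
  have hsemisimple := (Matrix.isSymmetric_toEuclideanLin_iff.2 hα).isFinitelySemisimple
  have hcharpoly : (Matrix.toEuclideanLin α).charpoly = α.charpoly := by
    rw [show Matrix.toEuclideanLin α = Matrix.toLin (PiLp.basisFun 2 𝕜 A) (PiLp.basisFun 2 𝕜 A) α by
      rw [← Matrix.toLpLin_eq_toLin], Matrix.charpoly_toLin]
  rw [← hcharpoly, ← LinearMap.finrank_maxGenEigenspace_eq,
    hsemisimple.maxGenEigenspace_eq_eigenspace]
  rfl

theorem IsHurwitz.dvd_rootMultiplicity {𝕜 A B : Type} [RCLike 𝕜] [Fintype A] [DecidableEq A]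
    [Fintype B] {n N : ℕ} {X : Fin (n + 1) → Matrix A B 𝕜} {α : Matrix A A 𝕜} {β : Matrix B B 𝕜}
    (h : IsHurwitz X α) (hβ : ∀ j, (X j)ᴴ * X j = β) (hN : CliffordDvd 𝕜 N n) {c : 𝕜}
    (hc : c ≠ 0) : N ∣ α.charpoly.rootMultiplicity c := by
  rw [← finrank_eigenspace_toLpLinAlgEquiv (h.isHermitian 0)]
  refine hN.dvd_finrank_eigenspace
    (T := fun j : Fin n => Matrix.toLpLinAlgEquiv 2 (X j.succ * (X 0)ᴴ))
    (fun j => (h.commute_mul_conjTranspose hβ _ _).map (Matrix.toLpLinAlgEquiv 2)) (fun j => ?_)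
    (fun j k hjk => ?_) hc
  · rw [← map_mul, ← map_mul, ← map_neg, h.mul_conjTranspose_mul_self hβ j.succ_ne_zero]
  · beta_reduce
    rw [← map_mul, ← map_mul, ← map_neg, h.mul_conjTranspose_anticomm hβ j.succ_ne_zero
      k.succ_ne_zero ((Fin.succ_injective n).ne hjk)]

theorem rootMultiplicity_of_nonzeroSpectrum {A : Type*} [Fintype A] [DecidableEq A]
    {τ : Matrix A A ℂ} {σ : Multiset ℝ} (h : nonzeroSpectrum τ = σ.map Complex.ofReal) {c : ℝ}
    (hc : c ≠ 0) : τ.charpoly.rootMultiplicity (c : ℂ) = σ.count c := by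
  rw [← Multiset.count_map_eq_count' Complex.ofReal σ Complex.ofReal_injective, ← h,
    nonzeroSpectrum, Multiset.count_filter_of_pos (by simpa using hc), Polynomial.count_roots]

theorem count_spectrumMultiset {r : ℕ} {lam : Fin r → ℝ} (hlam : Function.Injective lam)
    (m : Fin r → ℕ) (o : Fin r) : (spectrumMultiset lam m).count (lam o) = m o := by
  simp [spectrumMultiset, Multiset.count_sum', Multiset.count_replicate, hlam.eq_iff]

theorem dvd_of_existsComplexMasker {n r : ℕ} {lam : Fin r → ℝ} {m : Fin r → ℕ}
    (hs : IsStateSpectrum lam m) (h : ExistsComplexMasker (n + 1) (spectrumMultiset lam m))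
    (o : Fin r) : kappa (n + 1) ∣ m o := by
  obtain ⟨a, b, M, τA, τB, hM, hA, -⟩ := h
  obtain ⟨-, hXA, hXB⟩ := isMaskerWith_iff.1 hM
  have hne : lam o ≠ 0 := (hs.pos o).ne'
  rw [← count_spectrumMultiset hs.injective m o, ← rootMultiplicity_of_nonzeroSpectrum hA hne]
  exact hXA.dvd_rootMultiplicity hXB.conjTranspose_mul_self (CliffordDvd.complex n)
    (by exact_mod_cast hne)

section RealOutput

variable {N ι : Type*} [Fintype ι] {M : Matrix N ι ℂ}

theorem mul_star_add_eq_of_real_output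
    (hreal : ∀ ρ ∈ realDensityMatrices ι, ∀ x y, (conjBy M ρ x y).im = 0) (j k : ι) (x y : N) :
    M x j * star (M y k) + M x k * star (M y j) = star (M x j) * M y k + star (M x k) * M y j := by
  have hsum : ∀ ρ ∈ realDensityMatrices ι,
      ∑ j, ∑ k, ρ j k • (M x j * star (M y k) - star (M x j) * M y k) = 0 := fun ρ hρ => by
    have hconj := Complex.conj_eq_iff_im.2 (hreal ρ hρ x y)
    rw [conjBy_apply] at hconj
    simp only [smul_sub, Finset.sum_sub_distrib, sub_eq_zero]
    rw [← hconj]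
    have hρ' (j k : ι) : starRingEnd ℂ (ρ j k) = ρ j k := Complex.conj_eq_iff_im.2 (hρ.2 j k)
    simp [hρ']
  obtain ⟨hdiag, hoff⟩ := forall_real_sum_smul_eq_iff.1 hsum
  rcases eq_or_ne j k with rfl | hjk
  · linear_combination 2 * hdiag j
  · linear_combination hoff j k hjk

variable [Fintype N] [DecidableEq ι]

theorem eq_mul_star_of_real_output (hM : Mᴴ * M = 1)
    (hreal : ∀ ρ ∈ realDensityMatrices ι, ∀ x y, (conjBy M ρ x y).im = 0) (i : ι) (x : N) (j : ι) :
    M x j = (∑ y, M y i * M y i) * star (M x j) := by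
  have horth (j k : ι) : ∑ y, star (M y j) * M y k = if j = k then 1 else 0 := by
    rw [← Matrix.one_apply, ← hM]; rfl
  let U (j k : ι) : ℂ := ∑ y, M y j * M y k
  have hcontract (j k l : ι) (x : N) :
      M x j * (if k = l then 1 else 0) + M x k * (if j = l then 1 else 0) =
        star (M x j) * U k l + star (M x k) * U j l := by
    simp only [← horth, U, Finset.mul_sum, ← Finset.sum_add_distrib]
    exact Finset.sum_congr rfl fun y _ => by
      linear_combination M y l * mul_star_add_eq_of_real_output hreal j k x y
  have hdiag (j : ι) (x : N) : M x j = U j j * star (M x j) := by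
    have h := hcontract j j j x
    rw [if_pos rfl] at h
    linear_combination h / 2
  have hU (j : ι) : U j j = U i i := by
    rcases eq_or_ne i j with rfl | hij
    · rfl
    calc U j j = ∑ x, M x j * (star (M x j) * U i i + star (M x i) * U j i) :=
          Finset.sum_congr rfl fun x _ => by
            have h := hcontract j i i x
            rw [if_pos rfl, if_neg hij.symm] at h
            linear_combination M x j * h
      _ = (∑ x, star (M x j) * M x j) * U i i + (∑ x, star (M x i) * M x j) * U j i := by
          simp only [Finset.sum_mul, ← Finset.sum_add_distrib]
          exact Finset.sum_congr rfl fun x _ => by ring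
      _ = U i i := by rw [horth, horth, if_pos rfl, if_neg hij]; ring
  exact (hdiag j x).trans (by rw [hU j])

theorem exists_real_of_real_output [Nonempty ι] (hM : Mᴴ * M = 1)
    (hreal : ∀ ρ ∈ realDensityMatrices ι, ∀ x y, (conjBy M ρ x y).im = 0) :
    ∃ (c : ℂ) (R : Matrix N ι ℝ), c * star c = 1 ∧ M = c • R.map Complex.ofReal := by
  obtain ⟨i⟩ := ‹Nonempty ι›
  let u : ℂ := ∑ y, M y i * M y i
  have hMu (x : N) (j : ι) : M x j = u * star (M x j) := eq_mul_star_of_real_output hM hreal i x j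
  have huu : u * star u = 1 := by
    obtain ⟨x, hx⟩ : ∃ x, M x i ≠ 0 := by
      by_contra! hzero
      simpa [Matrix.mul_apply, hzero] using congrFun₂ hM i i
    refine mul_right_cancel₀ hx ?_
    have hstar : star (M x i) = star u * M x i := by
      conv_lhs => rw [hMu x i, star_mul', star_star]
    rw [one_mul, mul_assoc, ← hstar, ← hMu]
  obtain ⟨c, hc⟩ := IsAlgClosed.exists_pow_nat_eq u two_pos
  have hcc : c * star c = 1 := by
    have hu : ‖u‖ = 1 := by
      rw [Complex.star_def, Complex.mul_conj'] at huu
      exact (pow_eq_one_iff_of_nonneg (norm_nonneg u) two_ne_zero).1 (by exact_mod_cast huu)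
    have hnorm : ‖c‖ = 1 :=
      (pow_eq_one_iff_of_nonneg (norm_nonneg c) two_ne_zero).1 (by rw [← norm_pow, hc, hu])
    rw [Complex.star_def, Complex.mul_conj', hnorm, Complex.ofReal_one, one_pow]
  refine ⟨c, Matrix.of fun x j => (star c * M x j).re, hcc, ?_⟩
  ext x j
  have hre : ((star c * M x j).re : ℂ) = star c * M x j := by
    refine Complex.conj_eq_iff_re.1 ?_
    change star (star c * M x j) = _
    rw [star_mul', star_star]
    linear_combination -star c * hMu x j + star c * star (M x j) * hc - c * star (M x j) * hcc
  rw [Matrix.smul_apply, Matrix.map_apply, Matrix.of_apply, hre, smul_eq_mul, ← mul_assoc, hcc,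
    one_mul]

end RealOutput

theorem conjBy_smul {N ι : Type*} [Fintype ι] {c : ℂ} (hc : c * star c = 1) (M : Matrix N ι ℂ) :
    conjBy (c • M) = conjBy M := by
  funext ρ
  rw [conjBy, Matrix.conjTranspose_smul, Matrix.smul_mul, Matrix.smul_mul, Matrix.mul_smul,
    smul_smul, hc, one_smul, conjBy]

theorem IsMaskerWith.of_smul {ι A B : Type*} [Fintype ι] [DecidableEq ι] [Fintype A] [Fintype B]
    {c : ℂ} (hc : c * star c = 1) {M : Matrix (A × B) ι ℂ} {S : Set (Matrix ι ι ℂ)}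
    {τA : Matrix A A ℂ} {τB : Matrix B B ℂ} (h : IsMaskerWith (c • M) S τA τB) :
    IsMaskerWith M S τA τB := by
  refine ⟨?_, conjBy_smul hc M ▸ h.reducedA, conjBy_smul hc M ▸ h.reducedB⟩
  have hM := h.isometry
  rwa [Matrix.conjTranspose_smul, Matrix.smul_mul, Matrix.mul_smul, smul_smul, mul_comm, hc,
    one_smul] at hM

theorem dvd_of_existsRealMasker {n r : ℕ} {lam : Fin r → ℝ} {m : Fin r → ℕ}
    (hs : IsStateSpectrum lam m) (h : ExistsRealMasker (n + 1) (spectrumMultiset lam m))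
    (o : Fin r) : kappaR (n + 1) ∣ m o := by
  obtain ⟨a, b, M, ⟨τA, τB, hM, hA, -⟩, hreal⟩ := h
  have hne : lam o ≠ 0 := (hs.pos o).ne'
  obtain ⟨c, R, hc, rfl⟩ := exists_real_of_real_output hM.isometry fun ρ hρ => (hreal ρ hρ).2
  obtain ⟨-, hXA, hXB⟩ := isMaskerWith_iff.1 (hM.of_smul hc)
  let X : Fin (n + 1) → Matrix (Fin a) (Fin b) ℝ := columns R
  have hstar (x : ℝ) : Complex.ofRealHom (star x) = star (Complex.ofRealHom x) :=
    (Complex.conj_ofReal x).symm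
  obtain ⟨α, rfl⟩ : ∃ α : Matrix (Fin a) (Fin a) ℝ, α.map Complex.ofRealHom = τA :=
    ⟨X 0 * (X 0)ᴴ, by
      rw [Matrix.map_mul, Matrix.conjTranspose_map _ hstar]
      exact hXA.mul_conjTranspose_self 0⟩
  obtain ⟨β, rfl⟩ : ∃ β : Matrix (Fin b) (Fin b) ℝ, β.map Complex.ofRealHom = τB :=
    ⟨(X 0)ᵀ * (X 0)ᵀᴴ, by
      rw [Matrix.map_mul, Matrix.conjTranspose_map _ hstar]
      exact hXB.mul_conjTranspose_self 0⟩
  have hα : IsHurwitz X α := .of_map Complex.ofReal_injective hstar hXA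
  have hβ : IsHurwitz (fun j => (X j)ᵀ) β := .of_map Complex.ofReal_injective hstar hXB
  rw [← count_spectrumMultiset hs.injective m o, ← rootMultiplicity_of_nonzeroSpectrum hA hne,
    Matrix.charpoly_map, ← Complex.ofRealHom_eq_coe,
    ← Polynomial.eq_rootMultiplicity_map Complex.ofReal_injective]
  exact hα.dvd_rootMultiplicity hβ.conjTranspose_mul_self (CliffordDvd.real n) hne

/-! ### Maskers from Clifford matrices -/

section HurwitzConstruction

theorem IsHurwitz.mul_left {𝕜 ι A B : Type*} [CommRing 𝕜] [StarRing 𝕜] [Fintype A] [Fintype B]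
    {X : ι → Matrix A B 𝕜} {α : Matrix A A 𝕜} (h : IsHurwitz X α) (S : Matrix A A 𝕜) :
    IsHurwitz (fun j => S * X j) (S * α * Sᴴ) := by
  have hmul (j k : ι) : S * X j * (S * X k)ᴴ = S * (X j * (X k)ᴴ) * Sᴴ := by
    rw [Matrix.conjTranspose_mul]; simp only [Matrix.mul_assoc]
  refine ⟨fun j => by rw [hmul, h.mul_conjTranspose_self], fun j k hjk => ?_⟩
  rw [hmul, hmul, ← Matrix.add_mul, ← Matrix.mul_add, h.add_eq_zero j k hjk, Matrix.mul_zero,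
    Matrix.zero_mul]

theorem IsSkewClifford.transpose {ι 𝕜 I : Type*} [CommRing 𝕜] [StarRing 𝕜] [Fintype I]
    [DecidableEq I] {e : ι → Matrix I I 𝕜} (he : IsSkewClifford e) :
    IsSkewClifford fun j => (e j)ᵀ := by
  refine ⟨⟨fun j => ?_, fun j k hjk => ?_⟩, fun j => congrArg Matrix.transpose (he.star_eq j)⟩
  · rw [← Matrix.transpose_mul, he.mul_self, Matrix.transpose_neg, Matrix.transpose_one]
  · simp only [← Matrix.transpose_mul, he.anticomm hjk.symm, Matrix.transpose_neg]

variable {𝕜 I : Type*} [CommRing 𝕜] [StarRing 𝕜] [Fintype I] [DecidableEq I] {n : ℕ}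
  {e : Fin n → Matrix I I 𝕜}

theorem IsSkewClifford.isHurwitz_cons (he : IsSkewClifford e) :
    IsHurwitz (Fin.cons 1 e : Fin (n + 1) → Matrix I I 𝕜) 1 := by
  have hskew (j : Fin n) : (e j)ᴴ = -e j := he.star_eq j
  refine ⟨Fin.cases (by simp) fun j => by simp [hskew, he.mul_self], ?_⟩
  refine Fin.cases (Fin.cases (by simp) fun k _ => by simp [hskew])
    fun j => Fin.cases (by simp [hskew]) fun k hjk => ?_
  simp [hskew, he.anticomm (ne_of_apply_ne Fin.succ hjk)]

theorem IsSkewClifford.trace_conjTranspose_mul_cons [IsAddTorsionFree 𝕜] (he : IsSkewClifford e)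
    {D : Matrix I I 𝕜} (hcomm : ∀ j, Commute D (e j)) (htr : ∀ j, (D * e j).trace = 0)
    {j k : Fin (n + 1)} (hjk : j ≠ k) :
    (((Fin.cons 1 e : Fin (n + 1) → Matrix I I 𝕜) j)ᴴ *
      (D * (Fin.cons 1 e : Fin (n + 1) → Matrix I I 𝕜) k)).trace = 0 := by
  have hskew (j : Fin n) : (e j)ᴴ = -e j := he.star_eq j
  induction j using Fin.cases with
  | zero =>
    induction k using Fin.cases with
    | zero => exact absurd rfl hjk
    | succ k => simp [htr]
  | succ j =>
    induction k using Fin.cases with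
    | zero => simp [hskew, Matrix.trace_mul_comm (e j), htr]
    | succ k =>
      have hanti : e k * e j = -(e j * e k) := he.anticomm (ne_of_apply_ne Fin.succ hjk.symm)
      refine map_eq_zero_of_anticomm (Matrix.traceAddMonoidHom I 𝕜) Matrix.trace_mul_comm
        (he.isUnit j) ?_
      simp only [Fin.cons_succ, hskew, Matrix.neg_mul, Matrix.mul_neg, neg_neg]
      calc -(e j * (D * e k) * e j) = -(e j * (D * (e k * e j))) := by
            simp only [Matrix.mul_assoc]
        _ = e j * (e j * (D * e k)) := by
            rw [hanti, Matrix.mul_neg, Matrix.mul_neg, neg_neg, ← Matrix.mul_assoc D,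
              (hcomm j).eq, Matrix.mul_assoc]

end HurwitzConstruction

section DiagonalSpectrum

variable {I : Type*} [Fintype I] [DecidableEq I]

theorem roots_charpoly_diagonal {R : Type*} [CommRing R] [IsDomain R] (s : I → R) :
    (Matrix.diagonal s).charpoly.roots = Finset.univ.val.map s := by
  rw [Matrix.charpoly_diagonal, Polynomial.roots_prod]
  · simp
  · simp [Finset.prod_ne_zero_iff, Polynomial.X_sub_C_ne_zero]

theorem nonzeroSpectrum_diagonal {s : I → ℝ} (hs : ∀ i, s i ≠ 0) :
    nonzeroSpectrum (Matrix.diagonal fun i => (s i : ℂ)) =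
      (Finset.univ.val.map s).map Complex.ofReal := by
  rw [nonzeroSpectrum, roots_charpoly_diagonal, Multiset.map_map, Multiset.filter_eq_self.2]
  · rfl
  · simpa using hs

end DiagonalSpectrum

section CliffordMasker

/-- The diagonal matrix of the square roots of `s`: the Schmidt coefficients of the masked
states. -/
noncomputable def sqrtDiagonal {I : Type*} [DecidableEq I] (s : I → ℝ) : Matrix I I ℂ :=
  Matrix.diagonal fun i => (√(s i) : ℂ)

theorem conjTranspose_sqrtDiagonal {I : Type*} [DecidableEq I] (s : I → ℝ) :
    (sqrtDiagonal s)ᴴ = sqrtDiagonal s := by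
  simp [sqrtDiagonal, Matrix.diagonal_conjTranspose, Pi.star_def]

variable {I : Type*} [Fintype I] [DecidableEq I] {n : ℕ} {e : Fin n → Matrix I I ℂ} {s : I → ℝ}

theorem sqrtDiagonal_mul_self (hs : ∀ i, 0 ≤ s i) :
    sqrtDiagonal s * sqrtDiagonal s = Matrix.diagonal fun i => (s i : ℂ) := by
  simp [sqrtDiagonal, ← Complex.ofReal_mul, Real.mul_self_sqrt (hs _)]

/-- The masker whose columns are the Clifford generators `1, e 0, …, e (n - 1)`, weighted by the
Schmidt coefficients `√s`. -/
noncomputable def cliffordMasker (e : Fin n → Matrix I I ℂ) (s : I → ℝ) :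
    Matrix (I × I) (Fin (n + 1)) ℂ :=
  Matrix.of fun x j => (sqrtDiagonal s * (Fin.cons 1 e : Fin (n + 1) → Matrix I I ℂ) j) x.1 x.2

theorem columns_cliffordMasker (e : Fin n → Matrix I I ℂ) (s : I → ℝ) (j : Fin (n + 1)) :
    columns (cliffordMasker e s) j =
      sqrtDiagonal s * (Fin.cons 1 e : Fin (n + 1) → Matrix I I ℂ) j :=
  rfl

theorem isHurwitz_columns_cliffordMasker (he : IsSkewClifford e) (hs : ∀ i, 0 ≤ s i) :
    IsHurwitz (columns (cliffordMasker e s)) (Matrix.diagonal fun i => (s i : ℂ)) := by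
  have h := he.isHurwitz_cons.mul_left (sqrtDiagonal s)
  rwa [Matrix.mul_one, conjTranspose_sqrtDiagonal, sqrtDiagonal_mul_self hs] at h

theorem transpose_columns_cliffordMasker (hcomm : ∀ j, Commute (sqrtDiagonal s) (e j))
    (j : Fin (n + 1)) :
    (columns (cliffordMasker e s) j)ᵀ = columns (cliffordMasker (fun j => (e j)ᵀ) s) j := by
  have hS : (sqrtDiagonal s)ᵀ = sqrtDiagonal s := Matrix.diagonal_transpose _
  rw [columns_cliffordMasker, columns_cliffordMasker]
  induction j using Fin.cases with
  | zero => simp [hS]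
  | succ j => rw [Fin.cons_succ, Fin.cons_succ, hcomm j, Matrix.transpose_mul, hS]

theorem isometry_cliffordMasker (he : IsSkewClifford e) (hs : ∀ i, 0 ≤ s i)
    (hsum : ∑ i, s i = 1) (hcomm : ∀ j, Commute (sqrtDiagonal s) (e j))
    (htr : ∀ j, ((Matrix.diagonal fun i => (s i : ℂ)) * e j).trace = 0) :
    (cliffordMasker e s)ᴴ * cliffordMasker e s = 1 := by
  ext j k
  rw [conjTranspose_mul_apply, Matrix.one_apply]
  split_ifs with hjk
  · rw [hjk, Matrix.trace_mul_comm,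
      (isHurwitz_columns_cliffordMasker he hs).mul_conjTranspose_self, Matrix.trace_diagonal]
    exact_mod_cast hsum
  · have hcomm' (j : Fin n) : Commute (Matrix.diagonal fun i => (s i : ℂ)) (e j) :=
      sqrtDiagonal_mul_self hs ▸ (hcomm j).mul_left (hcomm j)
    rw [← he.trace_conjTranspose_mul_cons hcomm' htr hjk, ← sqrtDiagonal_mul_self hs,
      columns_cliffordMasker, columns_cliffordMasker, Matrix.conjTranspose_mul,
      conjTranspose_sqrtDiagonal]
    simp only [Matrix.mul_assoc]

theorem isMaskerWithSpectrum_cliffordMasker (he : IsSkewClifford e) (hs : ∀ i, 0 < s i)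
    (hsum : ∑ i, s i = 1) (hcomm : ∀ j, Commute (sqrtDiagonal s) (e j))
    (htr : ∀ j, ((Matrix.diagonal fun i => (s i : ℂ)) * e j).trace = 0) :
    IsMaskerWithSpectrum (cliffordMasker e s) (realDensityMatrices (Fin (n + 1)))
      (Finset.univ.val.map s) := by
  have hs' (i : I) : 0 ≤ s i := (hs i).le
  have hspec := nonzeroSpectrum_diagonal fun i => (hs i).ne'
  refine ⟨_, _, isMaskerWith_iff.2 ⟨isometry_cliffordMasker he hs' hsum hcomm htr,
    isHurwitz_columns_cliffordMasker he hs', ?_⟩, hspec, hspec⟩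
  simp only [transpose_columns_cliffordMasker hcomm]
  exact isHurwitz_columns_cliffordMasker he.transpose hs'

theorem im_cliffordMasker_eq_zero (he : ∀ j x y, (e j x y).im = 0) (x : I × I)
    (j : Fin (n + 1)) : (cliffordMasker e s x j).im = 0 := by
  change (((sqrtDiagonal s * (Fin.cons 1 e : Fin (n + 1) → Matrix I I ℂ) j) x.1 x.2).im) = 0
  rw [sqrtDiagonal, Matrix.diagonal_mul, Complex.im_ofReal_mul]
  refine mul_eq_zero_of_right _ ?_
  induction j using Fin.cases with
  | zero => rw [Fin.cons_zero, Matrix.one_apply]; split_ifs <;> simp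
  | succ j => exact he j _ _

end CliffordMasker

section Relabelling

variable {A B A' B' : Type*} [Fintype A] [Fintype B] [Fintype A'] [Fintype B']

theorem nonzeroSpectrum_submatrix [DecidableEq A] [DecidableEq A'] (τ : Matrix A A ℂ)
    (f : A' ≃ A) : nonzeroSpectrum (τ.submatrix f f) = nonzeroSpectrum τ := by
  have h : (τ.submatrix f f).charpoly = τ.charpoly := Matrix.charpoly_reindex f.symm τ
  rw [nonzeroSpectrum, h, nonzeroSpectrum]

theorem IsMaskerWithSpectrum.submatrix {ι : Type*} [Fintype ι] [DecidableEq ι] [DecidableEq A]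
    [DecidableEq B] [DecidableEq A'] [DecidableEq B'] {M : Matrix (A × B) ι ℂ}
    {S : Set (Matrix ι ι ℂ)} {σ : Multiset ℝ} (h : IsMaskerWithSpectrum M S σ) (f : A' ≃ A)
    (g : B' ≃ B) : IsMaskerWithSpectrum (M.submatrix (f.prodCongr g) id) S σ := by
  obtain ⟨τA, τB, hM, hA, hB⟩ := h
  refine ⟨τA.submatrix f f, τB.submatrix g g, ⟨?_, fun ρ hρ => ?_, fun ρ hρ => ?_⟩, ?_, ?_⟩
  · rw [Matrix.conjTranspose_submatrix, Matrix.submatrix_mul_equiv, hM.isometry,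
      Matrix.submatrix_id_id]
  · rw [← hM.reducedA ρ hρ]
    ext i j
    exact Equiv.sum_comp g fun k => conjBy M ρ (f i, k) (f j, k)
  · rw [← hM.reducedB ρ hρ]
    ext i j
    exact Equiv.sum_comp f fun k => conjBy M ρ (k, g i) (k, g j)
  · rw [nonzeroSpectrum_submatrix, hA]
  · rw [nonzeroSpectrum_submatrix, hB]

theorem hasRealOutput_of_im_eq_zero {ι : Type*} [Fintype ι] [DecidableEq ι] {M : Matrix (A × B) ι ℂ}
    (hM : Mᴴ * M = 1) (hr : ∀ x j, (M x j).im = 0) : HasRealOutput M (realDensityMatrices ι) := by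
  intro ρ hρ
  refine ⟨⟨hρ.1.1.mul_mul_conjTranspose_same M, ?_⟩, fun x y => ?_⟩
  · rw [conjBy, Matrix.trace_mul_cycle, hM, Matrix.one_mul, hρ.1.2]
  · simp [conjBy_apply, Complex.im_sum, Complex.mul_im, hr, hρ.2]

variable [DecidableEq A] [DecidableEq B] {d : ℕ} {M : Matrix (A × B) (Fin d) ℂ} {σ : Multiset ℝ}

theorem IsMaskerWithSpectrum.existsComplexMasker
    (h : IsMaskerWithSpectrum M (realDensityMatrices (Fin d)) σ) : ExistsComplexMasker d σ :=
  ⟨_, _, _, h.submatrix (Fintype.equivFin A).symm (Fintype.equivFin B).symm⟩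

theorem IsMaskerWithSpectrum.existsRealMasker
    (h : IsMaskerWithSpectrum M (realDensityMatrices (Fin d)) σ) (hr : ∀ x j, (M x j).im = 0) :
    ExistsRealMasker d σ := by
  have h' := h.submatrix (Fintype.equivFin A).symm (Fintype.equivFin B).symm
  obtain ⟨_, _, hM, -⟩ := id h'
  exact ⟨_, _, _, h', hasRealOutput_of_im_eq_zero hM.isometry fun x j => hr _ j⟩

end Relabelling

section Multiplicity

open scoped Kronecker

theorem map_univ_prod_sigma {r : ℕ} {I : Type*} [Fintype I] (lam : Fin r → ℝ) (c : Fin r → ℕ) :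
    (Finset.univ : Finset (I × (Σ o, Fin (c o)))).val.map (fun p => lam p.2.1) =
      spectrumMultiset lam fun o => Fintype.card I * c o := by
  have hmap {T : Type _} [Fintype T] (f : T → ℝ) :
      (Finset.univ : Finset T).val.map f = ∑ t, ({f t} : Multiset ℝ) :=
    (Multiset.sum_map_singleton _).symm.trans (by rw [Multiset.map_map]; rfl)
  rw [hmap, Fintype.sum_prod_type, spectrumMultiset]
  simp only [Fintype.sum_sigma, Finset.sum_const, Finset.card_univ, Fintype.card_fin,
    Finset.smul_sum, smul_smul, ← Multiset.nsmul_singleton]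

theorem sum_spectrumMultiset {r : ℕ} (lam : Fin r → ℝ) (m : Fin r → ℕ) :
    (spectrumMultiset lam m).sum = ∑ o, (m o : ℝ) * lam o := by
  rw [spectrumMultiset, ← Multiset.coe_sumAddMonoidHom, map_sum]
  simp

theorem diagonal_snd_eq_one_kronecker {I J : Type*} [DecidableEq I] [DecidableEq J] (t : J → ℂ) :
    (Matrix.diagonal fun p : I × J => t p.2) = 1 ⊗ₖ Matrix.diagonal t := by
  rw [← Matrix.diagonal_one, Matrix.diagonal_kronecker_diagonal]
  simp only [one_mul]

variable {n r : ℕ} {I : Type*} [Fintype I] [DecidableEq I] {e : Fin n → Matrix I I ℂ}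

theorem isMaskerWithSpectrum_cliffordMasker_kronecker_one (he : IsSkewClifford e)
    (htr : ∀ j, (e j).trace = 0) {lam : Fin r → ℝ} {c : Fin r → ℕ}
    (hs : IsStateSpectrum lam fun o => Fintype.card I * c o) :
    IsMaskerWithSpectrum
      (cliffordMasker (fun j => e j ⊗ₖ (1 : Matrix (Σ o, Fin (c o)) (Σ o, Fin (c o)) ℂ))
        fun p => lam p.2.1)
      (realDensityMatrices (Fin (n + 1))) (spectrumMultiset lam fun o => Fintype.card I * c o) := by
  rw [← map_univ_prod_sigma]
  refine isMaskerWithSpectrum_cliffordMasker (he.kronecker (one_mul 1) (star_one _))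
    (fun p => hs.pos p.2.1) ?_ (fun j => ?_) fun j => ?_
  · rw [Finset.sum, map_univ_prod_sigma, sum_spectrumMultiset, hs.sum_eq_one]
  · rw [sqrtDiagonal, diagonal_snd_eq_one_kronecker fun q : Σ o, Fin (c o) => (√(lam q.1) : ℂ),
      Commute, SemiconjBy, ← Matrix.mul_kronecker_mul, ← Matrix.mul_kronecker_mul]
    simp only [Matrix.one_mul, Matrix.mul_one]
  · rw [diagonal_snd_eq_one_kronecker fun q : Σ o, Fin (c o) => (lam q.1 : ℂ),
      ← Matrix.mul_kronecker_mul, Matrix.trace_kronecker, Matrix.one_mul, htr, zero_mul]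

end Multiplicity

theorem existsComplexMasker_of_dvd {n r : ℕ} (hn : 2 ≤ n) {lam : Fin r → ℝ} {m : Fin r → ℕ}
    (hs : IsStateSpectrum lam m) (hdvd : ∀ o, kappa (n + 1) ∣ m o) :
    ExistsComplexMasker (n + 1) (spectrumMultiset lam m) := by
  obtain ⟨e, he⟩ := ExistsSkewClifford.complex n
  have htr (j : Fin n) : (e j).trace = 0 := by
    have : Nontrivial (Fin n) := Fin.nontrivial_iff_two_le.2 hn
    obtain ⟨k, hk⟩ := exists_ne j
    exact map_eq_zero_of_anticomm (Matrix.traceAddMonoidHom _ ℂ) Matrix.trace_mul_comm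
      (he.isUnit k) (he.anticomm hk.symm)
  choose c hc using hdvd
  obtain rfl : m = fun o => Fintype.card (Fin (2 ^ (n / 2))) * c o :=
    funext fun o => by rw [hc, Fintype.card_fin]; rfl
  exact (isMaskerWithSpectrum_cliffordMasker_kronecker_one he htr hs).existsComplexMasker

theorem existsRealMasker_of_dvd {n r : ℕ} {lam : Fin r → ℝ} {m : Fin r → ℕ}
    (hs : IsStateSpectrum lam m) (hdvd : ∀ o, kappaR (n + 1) ∣ m o) :
    ExistsRealMasker (n + 1) (spectrumMultiset lam m) := by
  obtain ⟨e, he⟩ := ExistsSkewClifford.real n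
  have htr (j : Fin n) : (e j).trace = 0 := by
    have h := congrArg Matrix.trace (he.star_eq j)
    rw [Matrix.star_eq_conjTranspose, Matrix.trace_conjTranspose, Matrix.trace_neg,
      star_trivial] at h
    exact self_eq_neg.1 h
  have heC := he.map Complex.ofRealHom.mapMatrix fun x =>
    Matrix.ext fun i j => (Complex.conj_ofReal (x j i)).symm
  choose c hc using hdvd
  obtain rfl : m = fun o => Fintype.card (Fin (kappaR (n + 1))) * c o :=
    funext fun o => by rw [hc, Fintype.card_fin]
  refine (isMaskerWithSpectrum_cliffordMasker_kronecker_one heC (fun j => ?_) hs).existsRealMasker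
    (im_cliffordMasker_eq_zero fun j x y => ?_)
  · rw [RingHom.mapMatrix_apply, ← AddMonoidHom.map_trace, htr, map_zero]
  · rw [Matrix.kronecker_apply, Matrix.one_apply]
    split_ifs <;> simp

/-! ### The qubit -/

section Signs

theorem exists_eq_map_univ_of_map {α β : Type*} {f : α → β} {n : ℕ} {μ : Fin n → β}
    {s : Multiset α} (h : s.map f = Finset.univ.val.map μ) :
    ∃ w : Fin n → α, Finset.univ.val.map w = s ∧ ∀ l, f (w l) = μ l := by
  induction s using Quotient.inductionOn with
  | _ L =>
    rw [Fin.univ_val_map, Multiset.quot_mk_to_coe, Multiset.map_coe, Multiset.coe_eq_coe] at h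
    obtain ⟨W, hW, hLW⟩ : ∃ W : List α, List.ofFn μ = W.map f ∧ W.Perm L := by
      have hcomp : Relation.Comp (· = List.map f ·) List.Perm (List.ofFn μ) L := by
        rw [List.eq_map_comp_perm]
        exact h.symm
      exact hcomp
    obtain rfl : W.length = n := by simpa using congrArg List.length hW.symm
    refine ⟨W.get, ?_, fun l => ?_⟩
    · rw [Fin.univ_val_map, List.ofFn_get]
      exact Multiset.coe_eq_coe.2 hLW
    · have hfW : W.map f = List.ofFn (f ∘ W.get) := by rw [← List.map_ofFn, List.ofFn_get]
      exact (congrFun (List.ofFn_injective (hW.trans hfW)) l).symm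

theorem exists_signs_of_map_abs {n : ℕ} {μ : Fin n → ℝ} {s : Multiset ℝ}
    (h : s.map abs = Finset.univ.val.map μ) :
    ∃ v : Fin n → ℝ, (∀ l, v l = 1 ∨ v l = -1) ∧ ∑ l, v l * μ l = s.sum := by
  obtain ⟨w, rfl, hw⟩ := exists_eq_map_univ_of_map h
  have hsign (l : Fin n) : ∃ v : ℝ, (v = 1 ∨ v = -1) ∧ v * μ l = w l := by
    rcases abs_choice (w l) with habs | habs
    · exact ⟨1, .inl rfl, by rw [← hw, habs, one_mul]⟩
    · exact ⟨-1, .inr rfl, by rw [← hw, habs, neg_mul_neg, one_mul]⟩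
  choose v hv hvw using hsign
  exact ⟨v, hv, Finset.sum_congr rfl fun l _ => hvw l⟩

end Signs

section Qubit

theorem existsComplexMasker_two_of_signs {n : ℕ} {μ v : Fin n → ℝ} (hμ : ∀ l, 0 < μ l)
    (hsum : ∑ l, μ l = 1) (hv : ∀ l, v l = 1 ∨ v l = -1) (hvμ : ∑ l, v l * μ l = 0) :
    ExistsComplexMasker 2 (Finset.univ.val.map μ) := by
  let e : Fin 1 → Matrix (Fin n) (Fin n) ℂ := fun _ => Matrix.diagonal fun l => Complex.I * v l
  have hvv (l : Fin n) : (v l : ℂ) * v l = 1 := by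
    rcases hv l with h | h <;> simp [h]
  have he : IsSkewClifford e := by
    refine ⟨⟨fun _ => ?_, Subsingleton.pairwise⟩, fun _ => ?_⟩
    · simp only [e, Matrix.diagonal_mul_diagonal, mul_mul_mul_comm, Complex.I_mul_I, hvv, mul_one]
      rw [← Matrix.diagonal_one, Matrix.diagonal_neg]
    · simp [e, Matrix.star_eq_conjTranspose, Matrix.diagonal_conjTranspose, Pi.star_def]
  refine (isMaskerWithSpectrum_cliffordMasker he hμ hsum
    (fun _ => Matrix.commute_diagonal _ _) fun _ => ?_).existsComplexMasker
  calc ((Matrix.diagonal fun l => (μ l : ℂ)) * Matrix.diagonal fun l => Complex.I * v l).trace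
      = Complex.I * ((∑ l, v l * μ l : ℝ) : ℂ) := by
        rw [Matrix.diagonal_mul_diagonal, Matrix.trace_diagonal, Complex.ofReal_sum,
          Finset.mul_sum]
        exact Finset.sum_congr rfl fun l _ => by push_cast; ring
    _ = 0 := by rw [hvμ, Complex.ofReal_zero, mul_zero]

theorem roots_charpoly_mul_self {A : Type*} [Fintype A] [DecidableEq A] {K : Matrix A A ℂ}
    (hK : K.IsHermitian) :
    (K * K).charpoly.roots =
      Finset.univ.val.map fun i => ((hK.eigenvalues i * hK.eigenvalues i : ℝ) : ℂ) := by
  have h : K * K = Unitary.conjStarAlgAut ℂ _ hK.eigenvectorUnitary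
      (Matrix.diagonal fun i => ((hK.eigenvalues i * hK.eigenvalues i : ℝ) : ℂ)) := by
    conv_lhs => rw [hK.spectral_theorem, ← map_mul, Matrix.diagonal_mul_diagonal]
    simp
  rw [h, Unitary.conjStarAlgAut_apply, Matrix.charpoly_mul_comm, ← mul_assoc]
  simp only [Unitary.coe_star_mul_self, one_mul, roots_charpoly_diagonal]

theorem map_abs_eigenvalues_of_mul_self_eq {A : Type*} [Fintype A] [DecidableEq A]
    {K τ : Matrix A A ℂ} (hK : K.IsHermitian) (hτ : τ.PosSemidef) (h : K * K = τ * τ) :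
    Finset.univ.val.map (fun i => |hK.eigenvalues i|) =
      Finset.univ.val.map hτ.isHermitian.eigenvalues := by
  have hroots := congrArg (Multiset.map fun z : ℂ => √z.re) (roots_charpoly_mul_self hK)
  rw [h, roots_charpoly_mul_self hτ.isHermitian] at hroots
  simp only [Multiset.map_map, Function.comp_def, Complex.ofReal_re, Real.sqrt_mul_self_eq_abs,
    abs_of_nonneg (hτ.eigenvalues_nonneg _)] at hroots
  exact hroots.symm

theorem filter_map_abs_eigenvalues_of_mul_self_eq {A : Type*} [Fintype A] [DecidableEq A]
    {K τ : Matrix A A ℂ} (hK : K.IsHermitian) (hτ : τ.PosSemidef) (h : K * K = τ * τ)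
    {σ : Multiset ℝ} (hσ : nonzeroSpectrum τ = σ.map Complex.ofReal) :
    ((Finset.univ.val.map hK.eigenvalues).filter (· ≠ 0)).map abs = σ := by
  apply Multiset.map_injective Complex.ofReal_injective
  rw [← hσ, nonzeroSpectrum, hτ.isHermitian.roots_charpoly_eq_eigenvalues,
    ← Multiset.map_map, ← map_abs_eigenvalues_of_mul_self_eq hK hτ h]
  simp only [Multiset.filter_map, Multiset.map_map, Function.comp_def]
  simp

theorem sum_filter_ne_zero {G : Type*} [AddCommMonoid G] [DecidableEq G] (s : Multiset G) :
    (s.filter (· ≠ 0)).sum = s.sum := by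
  have hzero : (s.filter (¬· ≠ 0)).sum = 0 :=
    Multiset.sum_eq_zero fun x hx => not_not.1 (Multiset.mem_filter.1 hx).2
  rw [← Multiset.sum_filter_add_sum_filter_not (s := s) (· ≠ 0), hzero, add_zero]

theorem IsHurwitz.isHermitian_I_smul {ι A B : Type*} [Fintype B]
    {X : ι → Matrix A B ℂ} {α : Matrix A A ℂ} (h : IsHurwitz X α) {i j : ι} (hij : j ≠ i) :
    (Complex.I • (X j * (X i)ᴴ)).IsHermitian := by
  rw [Matrix.IsHermitian, Matrix.conjTranspose_smul, Matrix.conjTranspose_mul,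
    Matrix.conjTranspose_conjTranspose, h.mul_conjTranspose_comm hij.symm, Complex.star_def,
    Complex.conj_I, smul_neg, neg_smul, neg_neg]

theorem exists_signs_of_existsComplexMasker_two {n : ℕ} {μ : Fin n → ℝ}
    (h : ExistsComplexMasker 2 (Finset.univ.val.map μ)) :
    ∃ v : Fin n → ℝ, (∀ l, v l = 1 ∨ v l = -1) ∧ ∑ l, v l * μ l = 0 := by
  obtain ⟨a, b, M, τA, τB, hM, hA, -⟩ := h
  obtain ⟨hiso, hXA, hXB⟩ := isMaskerWith_iff.1 hM
  have hpos : τA.PosSemidef := by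
    rw [← hXA.mul_conjTranspose_self 0]
    exact Matrix.posSemidef_self_mul_conjTranspose _
  have hK := hXA.isHermitian_I_smul (one_ne_zero (α := Fin 2))
  have hKK : (Complex.I • (columns M 1 * (columns M 0)ᴴ)) *
      (Complex.I • (columns M 1 * (columns M 0)ᴴ)) = τA * τA := by
    rw [smul_mul_smul_comm, Complex.I_mul_I,
      hXA.mul_conjTranspose_mul_self hXB.conjTranspose_mul_self one_ne_zero, smul_neg, neg_smul,
      one_smul, neg_neg]
  have htr : ∑ i, hK.eigenvalues i = 0 := by
    have htrace := hK.trace_eq_sum_eigenvalues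
    rw [Matrix.trace_smul, Matrix.trace_mul_comm, ← conjTranspose_mul_apply, hiso,
      Matrix.one_apply_ne zero_ne_one, smul_zero] at htrace
    simpa using congrArg Complex.re htrace.symm
  obtain ⟨v, hv, hvμ⟩ := exists_signs_of_map_abs
    (filter_map_abs_eigenvalues_of_mul_self_eq hK hpos hKK hA)
  exact ⟨v, hv, by rw [hvμ, sum_filter_ne_zero]; exact htr⟩

end Qubit

end QMask

theorem corollary4 :
    (∀ d : ℕ, 3 ≤ d → ∀ (r : ℕ) (lam : Fin r → ℝ) (m : Fin r → ℕ),
      QMask.IsStateSpectrum lam m →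
        (QMask.ExistsComplexMasker d (QMask.spectrumMultiset lam m) ↔
          ∀ o, QMask.kappa d ∣ m o)) ∧
    (∀ d : ℕ, 2 ≤ d → ∀ (r : ℕ) (lam : Fin r → ℝ) (m : Fin r → ℕ),
      QMask.IsStateSpectrum lam m →
        (QMask.ExistsRealMasker d (QMask.spectrumMultiset lam m) ↔
          ∀ o, QMask.kappaR d ∣ m o)) ∧
    (∀ (n : ℕ) (μ : Fin n → ℝ), (∀ l, 0 < μ l) → ∑ l, μ l = 1 →
      (QMask.ExistsComplexMasker 2 (Finset.univ.val.map μ) ↔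
        ∃ v : Fin n → ℝ, (∀ l, v l = 1 ∨ v l = -1) ∧ ∑ l, v l * μ l = 0)) := by
  refine ⟨fun d hd r lam m hs => ?_, fun d hd r lam m hs => ?_, fun n μ hμ hsum => ?_⟩
  · obtain ⟨n, rfl⟩ : ∃ n, d = n + 1 := ⟨d - 1, by omega⟩
    exact ⟨QMask.dvd_of_existsComplexMasker hs,
      QMask.existsComplexMasker_of_dvd (by omega) hs⟩
  · obtain ⟨n, rfl⟩ : ∃ n, d = n + 1 := ⟨d - 1, by omega⟩
    exact ⟨QMask.dvd_of_existsRealMasker hs, QMask.existsRealMasker_of_dvd hs⟩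
  · exact ⟨QMask.exists_signs_of_existsComplexMasker_two, fun ⟨v, hv, hvμ⟩ =>
      QMask.existsComplexMasker_two_of_signs hμ hsum hv hvμ⟩
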